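/- All spaces are compactly generated, and products and subspaces are taken in that category. A *pair* $(X,A)$ is a pointed space $X$ with a subspace $A$ containing the basepoint; maps of pairs are pointed. A *power couple* is a pair $(X,A)$ with maps of pairs $\rho_a:(X,A)\to(X,A)$, $a\ge 1$, such that $\rho_1=\mathrm{id}$ and $\rho_a\circ\rho_b=\rho_{ab}$; a map between power couples is a map of pairs commuting with all $\rho_a$. It is a *CW-power couple* if $X$ is obtained from $A$ by successively attaching cells (along not necessarily cellular maps). A map of pairs $f:(X,A)\to(Y,B)$ is a *homotopy equivalence of pairs* if there are a map of pairs $g:(Y,B)\to(X,A)$ and homotopies $H:X\times[0,1]\to X$ from $\mathrm{id}_X$ to $g\circ f$ and $K:Y\times[0,1]\to Y$ from $\mathrm{id}_Y$ to $f\circ g$ with $H(A\times[0,1])\subseteq A$ and $K(B\times[0,1])\subseteq B$; it is a *homeomorphism of pairs* if there is a map of pairs $g$ with $g\circ f=\mathrm{id}_X$ and $f\circ g=\mathrm{id}_Y$. Let $\Delta^{m-1}$ be the poset of all subsets of $\{1,\dots,m\}$, including $\emptyset$. A *power sequence* is a map $c:\Delta^{m-1}\to\mathbb{N}_{>0}^m$,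 $\sigma\mapsto(c^\sigma_1,\dots,c^\sigma_m)$, with $c^\sigma_i=1$ for $i\notin\sigma$ and $c^\tau_i\mid c^\sigma_i$ for $\tau\subseteq\sigma$. For a sequence $(\underline X,\underline A)=\{(X_i,A_i)\}_{i=1}^m$ of power couples put $(\underline X,\underline A)^\sigma=\{x\in\prod_i X_i : x_i\in A_i \text{ for } i\notin\sigma\}$ and $(\underline X,\underline A)^{\partial\sigma}=\operatorname{colim}_{\tau\subsetneq\sigma}(\underline X,\underline A)^\tau$, and for $\tau\subseteq\sigma$ let $\underline c^{\sigma/\tau}=\prod_i\rho_{c^\sigma_i/c^\tau_i}$. A *weighted polyhedral product system* $\{(\underline X,\underline A)^{\bullet,c},\eta(\bullet)\}$ consists of a functor $\sigma\mapsto(\underline X,\underline A)^{\sigma,c}$ from $\Delta^{m-1}$ to pointed spaces, with maps $\imath^{\sigma,c}_{\tau,c}$ for $\tau\subseteq\sigma$, and pointed maps $\eta(\sigma):(\underline X,\underline A)^\sigma\to(\underline X,\underline A)^{\sigma,c}$ such that $\eta(\emptyset)$ identifies $\prod_i A_i$ with $(\underline X,\underline A)^{\emptyset,c}$ and, for $\sigma\ne\emptyset$,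 $(\underline X,\underline A)^{\sigma,c}$ together with $\eta(\sigma)$ and the canonical map from $(\underline X,\underline A)^{\partial\sigma,c}$ is the pushout of $$(\underline X,\underline A)^{\partial\sigma,c}\xleftarrow{\ \eta(\partial\sigma)\ }(\underline X,\underline A)^{\partial\sigma}\longrightarrow(\underline X,\underline A)^{\sigma},$$ where $(\underline X,\underline A)^{\partial\sigma,c}=\operatorname{colim}_{\tau\subsetneq\sigma}(\underline X,\underline A)^{\tau,c}$ and $\eta(\partial\sigma)$ is given on $(\underline X,\underline A)^\tau$ by $\underline c^{\sigma/\tau}$ followed by $\eta(\tau)$ and the map into the colimit. **Proposition.** Let $c$ be a power sequence, let $\{(X_i,A_i)\}_{i=1}^m$ and $\{(Y_i,B_i)\}_{i=1}^m$ be sequences of power couples with weighted polyhedral product systems $\{(\underline X,\underline A)^{\bullet,c},\eta(\bullet)\}$ and $\{(\underline Y,\underline B)^{\bullet,c},\widetilde\eta(\bullet)\}$ (with maps $\imath$ and $\widetilde\imath$), and let $\varphi_i:(X_i,A_i)\to(Y_i,B_i)$, $1\le i\le m$, be maps between power couples. Then there is a unique collection of maps $\varphi(\sigma):(\underline X,\underline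 A)^{\sigma,c}\to(\underline Y,\underline B)^{\sigma,c}$, $\sigma\in\Delta^{m-1}$, such that for all $\tau\subseteq\sigma$ $$\varphi(\sigma)\circ\imath^{\sigma,c}_{\tau,c}=\widetilde\imath^{\,\sigma,c}_{\tau,c}\circ\varphi(\tau)\qquad\text{and}\qquad \varphi(\sigma)\circ\eta(\sigma)=\widetilde\eta(\sigma)\circ\Big(\prod_{i=1}^m\varphi_i\Big)\Big|_{(\underline X,\underline A)^\sigma},$$ and these maps are pointed. If all $\varphi_i$ are homeomorphisms of pairs, then every $\varphi(\sigma)$ is a homeomorphism of pairs. If all $(X_i,A_i)$ and all $(Y_i,B_i)$ are CW-power couples and all $\varphi_i$ are homotopy equivalences of pairs, then every $\varphi(\sigma)$ is a homotopy equivalence of pairs. Here $(\underline X,\underline A)^{\sigma,c}$ is paired with the image of $(\underline X,\underline A)^{\tau,c}$ for any $\tau\subseteq\sigma$ (for $\tau=\sigma$ this says that $\varphi(\sigma)$ itself is a homeomorphism, respectively a homotopy equivalence), or with the image of $(\underline X,\underline A)^{\partial\sigma,c}$, and $(\underline Y,\underline B)^{\sigma,c}$ with the corresponding subspace. (For $\sigma=\emptyset$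 the boundary subspace is empty; the definitions above are then read without the requirement that the subspace contain the basepoint.) -/

import Mathlib

open CategoryTheory CategoryTheory.Limits

universe u

/-! ### Maps of pairs -/

/-- A continuous map `f : X → Y` is a map of pointed pairs `(X, A) → (Y, B)`, where `X` and `Y`
have the basepoints `x₀` and `y₀`. -/
structure IsMapOfPairs {X Y : Type u} [TopologicalSpace X] [TopologicalSpace Y]
    (A : Set X) (x₀ : X) (B : Set Y) (y₀ : Y) (f : C(X, Y)) : Prop where
  mapsTo : Set.MapsTo f A B
  map_base : f x₀ = y₀

/-- `f : (X, A) → (Y, B)` is a homeomorphism of (pointed) pairs: it has a two-sided inverse that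
is a map of pairs. -/
def IsHomeomorphismOfPairs {X Y : Type u} [TopologicalSpace X] [TopologicalSpace Y]
    (A : Set X) (x₀ : X) (B : Set Y) (y₀ : Y) (f : C(X, Y)) : Prop :=
  IsMapOfPairs A x₀ B y₀ f ∧
    ∃ g : C(Y, X), IsMapOfPairs B y₀ A x₀ g ∧
      g.comp f = ContinuousMap.id X ∧ f.comp g = ContinuousMap.id Y

/-- `f : (X, A) → (Y, B)` is a homotopy equivalence of (pointed) pairs: there are a map of pairs
`g : (Y, B) → (X, A)` and homotopies `H` from `id` to `g ∘ f` and `K` from `id` to `f ∘ g` with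
`H (A × [0,1]) ⊆ A` and `K (B × [0,1]) ⊆ B`. -/
def IsHomotopyEquivOfPairs {X Y : Type u} [TopologicalSpace X] [TopologicalSpace Y]
    (A : Set X) (x₀ : X) (B : Set Y) (y₀ : Y) (f : C(X, Y)) : Prop :=
  IsMapOfPairs A x₀ B y₀ f ∧
    ∃ g : C(Y, X), IsMapOfPairs B y₀ A x₀ g ∧
      (∃ H : (ContinuousMap.id X).Homotopy (g.comp f), ∀ t, ∀ a ∈ A, H (t, a) ∈ A) ∧
      (∃ K : (ContinuousMap.id Y).Homotopy (f.comp g), ∀ t, ∀ b ∈ B, K (t, b) ∈ B)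

/-! ### Power couples -/

/-- A power couple: a pointed pair `(X, A)`, with `X` compactly generated, together with power
maps `ρ_a : (X, A) → (X, A)`, one for each positive integer `a`, such that `ρ_1 = id` and
`ρ_a ∘ ρ_b = ρ_{ab}`. -/
structure PowerCouple : Type (u + 1) where
  carrier : Type u
  [topology : TopologicalSpace carrier]
  [compactlyGenerated : CompactlyGeneratedSpace carrier]
  sub : Set carrier
  base : carrier
  base_mem : base ∈ sub
  pow : ℕ+ → C(carrier, carrier)
  isMapOfPairs_pow : ∀ a, IsMapOfPairs sub base sub base (pow a)
  pow_one : pow 1 = ContinuousMap.id carrier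
  pow_comp : ∀ a b, (pow a).comp (pow b) = pow (a * b)

namespace PowerCouple

instance : CoeSort PowerCouple.{u} (Type u) := ⟨carrier⟩

instance (X : PowerCouple.{u}) : TopologicalSpace X := X.topology

instance (X : PowerCouple.{u}) : CompactlyGeneratedSpace X := X.compactlyGenerated

/-- A map between power couples: a map of pairs that commutes with the power maps. (The square
for the subspaces is the restriction of the square for the ambient spaces.) -/
structure Hom (X Y : PowerCouple.{u}) where
  map : C(X, Y)
  isMapOfPairs : IsMapOfPairs X.sub X.base Y.sub Y.base map
  comm : ∀ a : ℕ+, map.comp (X.pow a) = (Y.pow a).comp map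

/-- The underlying map of pairs is a homeomorphism of pairs. -/
def Hom.IsHomeomorphism {X Y : PowerCouple.{u}} (f : Hom X Y) : Prop :=
  IsHomeomorphismOfPairs X.sub X.base Y.sub Y.base f.map

/-- The underlying map of pairs is a homotopy equivalence of pairs. -/
def Hom.IsHomotopyEquiv {X Y : PowerCouple.{u}} (f : Hom X Y) : Prop :=
  IsHomotopyEquivOfPairs X.sub X.base Y.sub Y.base f.map

/-- The inclusion of the subspace `A` in `X`. -/
def subInclusion (X : PowerCouple.{u}) : TopCat.of X.sub ⟶ TopCat.of X :=
  TopCat.ofHom ⟨Subtype.val, continuous_subtype_val⟩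

/-- A CW-power couple: `X` is obtained from `A` by adding cells, i.e. `X` is the union (colimit)
of a sequence starting with `A` in which each term arises from the previous one by attaching a set
of disks along arbitrary continuous maps of their boundary spheres. The attaching maps need not be
cellular: disks of any dimensions may be attached at each step. -/
def IsCW (X : PowerCouple.{u}) : Prop :=
  Nonempty (HomotopicalAlgebra.RelativeCellComplex.{u} (J := ℕ)
    (fun (_ : ℕ) (n : ℕ) => TopCat.diskBoundaryInclusion.{u} n) X.subInclusion)

end PowerCouple

/-! ### Power sequences -/

/-- A power sequence of length `m`; the faces of the simplex `Δ^{m-1}`, including the empty face,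
are the finite subsets of the vertex set `Fin m`. -/
structure PowerSequence (m : ℕ) where
  toFun : Finset (Fin m) → Fin m → ℕ+
  eq_one : ∀ σ i, i ∉ σ → toFun σ i = 1
  dvd : ∀ τ σ, τ ⊆ σ → ∀ i, toFun τ i ∣ toFun σ i

namespace PowerSequence

/-- The exact quotients `c^σ_i / c^τ_i`, for `τ ⊆ σ`. -/
def ratio {m : ℕ} (c : PowerSequence m) (σ τ : Finset (Fin m)) (i : Fin m) : ℕ+ :=
  PNat.divExact (c.toFun σ i) (c.toFun τ i)

theorem ratio_spec {m : ℕ} (c : PowerSequence m) {σ τ : Finset (Fin m)} (h : τ ⊆ σ) (i : Fin m) :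
    c.toFun τ i * c.ratio σ τ i = c.toFun σ i :=
  PNat.mul_div_exact (c.dvd τ σ h i)

end PowerSequence

/-! ### Compactly generated topologies -/

/-- A copy of the type `S`, to carry the compactly generated topology. -/
def Kified (S : Type u) : Type u := S

/-- The compactly generated topology of a topological space `S`: the finest topology for which all
maps from compact Hausdorff spaces to `S` that are continuous for the original topology are
continuous. -/
instance (S : Type u) [TopologicalSpace S] : TopologicalSpace (Kified S) :=
  TopologicalSpace.compactlyGenerated.{u} S

theorem continuous_kified {S T : Type u} [TopologicalSpace S] [TopologicalSpace T]
    {f : S → T} (hf : Continuous f) :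
    Continuous (X := Kified S) (Y := Kified T) f := by
  let F : (Σ i : (K : CompHaus.{u}) × C(K, T), i.fst) → Kified T := fun p => p.1.2 p.2
  have hF : Continuous F := continuous_coinduced_rng
  refine continuous_from_compactlyGenerated.{u} (X := S) (Y := Kified T) f fun K g => ?_
  exact hF.comp (continuous_sigmaMk
    (σ := fun i : (K : CompHaus.{u}) × C(K, T) => i.fst) (i := ⟨K, ⟨f ∘ g, hf.comp g.continuous⟩⟩))

/-- The space `S` with its compactly generated topology. -/
def kSpace (S : Type u) [TopologicalSpace S] : TopCat.{u} :=
  TopCat.of (Kified S)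

/-- A continuous map remains continuous for the compactly generated topologies. -/
def kMap {S T : Type u} [TopologicalSpace S] [TopologicalSpace T] (f : S → T)
    (hf : Continuous f) : kSpace S ⟶ kSpace T :=
  TopCat.ofHom (X := Kified S) (Y := Kified T) ⟨f, continuous_kified hf⟩

/-! ### Polyhedral products of simplices -/

variable {m : ℕ}

/-- The points of `(X, A)^σ`: those `x` in the product of the `X i` with `x i ∈ A i` whenever
`i ∉ σ`. -/
def polySet (X : Fin m → PowerCouple.{u}) (σ : Finset (Fin m)) : Set (∀ i, X i) :=
  {x | ∀ i, i ∉ σ → x i ∈ (X i).sub}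

/-- The space `(X, A)^σ`, as a subspace of the product, in the compactly generated sense. -/
def polyObj (X : Fin m → PowerCouple.{u}) (σ : Finset (Fin m)) : TopCat.{u} :=
  kSpace (polySet X σ)

/-- The basepoint of `(X, A)^σ`. -/
def polyBase (X : Fin m → PowerCouple.{u}) (σ : Finset (Fin m)) : polyObj X σ :=
  (⟨fun i => (X i).base, fun i _ => (X i).base_mem⟩ : polySet X σ)

/-- The functor `σ ↦ (X, A)^σ` on the faces of the simplex, with inclusions as maps. -/
def polyFunctor (X : Fin m → PowerCouple.{u}) : Finset (Fin m) ⥤ TopCat.{u} where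
  obj σ := polyObj X σ
  map {τ σ} h := kMap
    (fun x : polySet X τ => (⟨x.1, fun i hi => x.2 i fun h' => hi (leOfHom h h')⟩ : polySet X σ))
    (by fun_prop)
  map_id _ := rfl
  map_comp _ _ := rfl

/-- The power map `ρ_{a_1} × ⋯ × ρ_{a_m}` of `(X, A)^σ`. -/
def polyPow (X : Fin m → PowerCouple.{u}) (a : Fin m → ℕ+) (σ : Finset (Fin m)) :
    (polyFunctor X).obj σ ⟶ (polyFunctor X).obj σ :=
  kMap
    (fun x : polySet X σ => (⟨fun i => (X i).pow (a i) (x.1 i),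
      fun i hi => ((X i).isMapOfPairs_pow (a i)).mapsTo (x.2 i hi)⟩ : polySet X σ))
    (by
      refine Continuous.subtype_mk (continuous_pi fun i => ?_) _
      exact ((X i).pow (a i)).continuous.comp ((continuous_apply i).comp continuous_subtype_val))

/-- The map `(X, A)^σ → (Y, B)^σ` that is the restriction of the product of the maps `φ i`. -/
def polyMap {X Y : Fin m → PowerCouple.{u}} (φ : ∀ i, (X i).Hom (Y i)) (σ : Finset (Fin m)) :
    (polyFunctor X).obj σ ⟶ (polyFunctor Y).obj σ :=
  kMap
    (fun x : polySet X σ => (⟨fun i => (φ i).map (x.1 i),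
      fun i hi => (φ i).isMapOfPairs.mapsTo (x.2 i hi)⟩ : polySet Y σ))
    (by
      refine Continuous.subtype_mk (continuous_pi fun i => ?_) _
      exact (φ i).map.continuous.comp ((continuous_apply i).comp continuous_subtype_val))

/-! ### Boundaries -/

/-- The proper faces of `σ`, including the empty face if `σ` is nonempty; they are ordered by
inclusion. -/
abbrev ProperFace (σ : Finset (Fin m)) : Type := {τ : Finset (Fin m) // τ ⊂ σ}

/-- The restriction of a functor on the faces of the simplex to the proper faces of `σ`. -/
def properFaces (F : Finset (Fin m) ⥤ TopCat.{u}) (σ : Finset (Fin m)) :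
    ProperFace σ ⥤ TopCat.{u} :=
  (Subtype.mono_coe (· ⊂ σ)).functor ⋙ F

/-- The value at `∂σ`: the colimit over the proper faces of `σ`. For `polyFunctor X` it is
`(X, A)^{∂σ}`, the union of the `(X, A)^τ` over `τ ⊊ σ`, with the colimit topology. -/
noncomputable def boundary (F : Finset (Fin m) ⥤ TopCat.{u}) (σ : Finset (Fin m)) : TopCat.{u} :=
  colimit (properFaces F σ)

/-- The map from the value at a proper face `τ` of `σ` to the value at `∂σ`. -/
noncomputable def toBoundary (F : Finset (Fin m) ⥤ TopCat.{u}) (σ : Finset (Fin m))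
    (τ : ProperFace σ) : F.obj τ.1 ⟶ boundary F σ :=
  colimit.ι (properFaces F σ) τ

/-- The map from the value at `∂σ` to the value at `σ` that is induced by the maps
`F τ → F σ`, for `τ ⊊ σ`. -/
noncomputable def boundaryMap (F : Finset (Fin m) ⥤ TopCat.{u}) (σ : Finset (Fin m)) :
    boundary F σ ⟶ F.obj σ :=
  colimit.desc (properFaces F σ)
    { pt := F.obj σ
      ι :=
        { app := fun τ => F.map (homOfLE τ.2.subset)
          naturality := fun τ μ h => by
            simp only [properFaces, Functor.comp_map, Functor.const_obj_map]
            rw [← F.map_comp]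
            rfl } }

/-! ### Weighted polyhedral product systems -/

/-- A weighted polyhedral product system for the sequence `X` of power couples and the power
sequence `c`: a functor `σ ↦ (X, A)^{σ,c}` from the faces of the simplex to pointed spaces and
pointed maps `η σ : (X, A)^σ → (X, A)^{σ,c}` such that

* `η ∅` identifies `(X, A)^{∅,c}` with `(X, A)^∅`, the product of the subspaces `A i`;
* for `σ` nonempty, `(X, A)^{σ,c}` is the pushout of
  `(X, A)^{∂σ,c} ← (X, A)^{∂σ} → (X, A)^σ`, where `(X, A)^{∂σ,c}` is the colimit of the
  `(X, A)^{τ,c}` over `τ ⊊ σ`, and `η(∂σ) : (X, A)^{∂σ} → (X, A)^{∂σ,c}` is the map whose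
  restriction to `(X, A)^τ`, for `τ ⊊ σ`, is
  `(X, A)^τ → (X, A)^τ → (X, A)^{τ,c} → (X, A)^{∂σ,c}`, the power map `c^{σ/τ}` followed by `η τ`
  and the map into the colimit.

All the spaces are compactly generated: `(X, A)^∅` and `(X, A)^σ` are, and colimits of compactly
generated spaces are formed in topological spaces. The index categories are connected, so
colimits of pointed spaces are colimits of spaces. -/
structure WeightedSystem (X : Fin m → PowerCouple.{u}) (c : PowerSequence m) where
  /-- the functor `σ ↦ (X, A)^{σ,c}` -/
  functor : Finset (Fin m) ⥤ TopCat.{u}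
  /-- the basepoint of `(X, A)^{σ,c}` -/
  base : ∀ σ, functor.obj σ
  map_base : ∀ {τ σ : Finset (Fin m)} (h : τ ⟶ σ), functor.map h (base τ) = base σ
  /-- the map `η(σ)` -/
  η : ∀ σ, (polyFunctor X).obj σ ⟶ functor.obj σ
  η_base : ∀ σ, η σ (polyBase X σ) = base σ
  isIso_η_empty : IsIso (η ∅)
  /-- the map `η(∂σ)` -/
  ηBoundary : ∀ σ, boundary (polyFunctor X) σ ⟶ boundary functor σ
  toBoundary_ηBoundary : ∀ (σ : Finset (Fin m)) (τ : ProperFace σ),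
    toBoundary (polyFunctor X) σ τ ≫ ηBoundary σ =
      polyPow X (c.ratio σ τ.1) τ.1 ≫ η τ.1 ≫ toBoundary functor σ τ
  isPushout : ∀ σ : Finset (Fin m), σ.Nonempty →
    IsPushout (boundaryMap (polyFunctor X) σ) (ηBoundary σ) (η σ) (boundaryMap functor σ)

namespace WeightedSystem

variable {X : Fin m → PowerCouple.{u}} {c : PowerSequence m} (W : WeightedSystem X c)

/-- The space `(X, A)^{σ,c}`. -/
abbrev obj (σ : Finset (Fin m)) : TopCat.{u} := W.functor.obj σ

/-- The map `(X, A)^{τ,c} → (X, A)^{σ,c}` for `τ ⊆ σ`. -/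
abbrev incl {τ σ : Finset (Fin m)} (h : τ ⊆ σ) : W.obj τ ⟶ W.obj σ :=
  W.functor.map (homOfLE h)

/-- The subspace of `(X, A)^{σ,c}` given by a face `τ ⊆ σ`: the image of `(X, A)^{τ,c}`. -/
def faceSet {τ σ : Finset (Fin m)} (h : τ ⊆ σ) : Set (W.obj σ) :=
  Set.range (W.incl h)

/-- The subspace of `(X, A)^{σ,c}` given by the boundary of `σ`: the image of
`(X, A)^{∂σ,c}`. -/
def boundarySet (σ : Finset (Fin m)) : Set (W.obj σ) :=
  Set.range (boundaryMap W.functor σ)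

end WeightedSystem

/-! ### Existence of weighted polyhedral product systems -/

namespace WeightedSystem

theorem polyPow_incl (X : Fin m → PowerCouple.{u}) (a : Fin m → ℕ+) {τ σ : Finset (Fin m)}
    (h : τ ⟶ σ) :
    (polyFunctor X).map h ≫ polyPow X a σ = polyPow X a τ ≫ (polyFunctor X).map h := rfl

theorem polyPow_comp (X : Fin m → PowerCouple.{u}) (a b d : Fin m → ℕ+) (σ : Finset (Fin m))
    (h : ∀ i, b i * a i = d i) : polyPow X a σ ≫ polyPow X b σ = polyPow X d σ := by
  ext x
  apply Subtype.ext
  funext i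
  change ((X i).pow (b i)) ((X i).pow (a i) (x.1 i)) = (X i).pow (d i) (x.1 i)
  rw [← h i, ← (X i).pow_comp]
  rfl

theorem ratio_mul (c : PowerSequence m) {μ τ σ : Finset (Fin m)} (h : μ ⊆ τ) (h' : τ ⊆ σ)
    (i : Fin m) : c.ratio τ μ i * c.ratio σ τ i = c.ratio σ μ i := by
  apply mul_left_cancel (a := c.toFun μ i)
  rw [c.ratio_spec (h.trans h'), ← mul_assoc, c.ratio_spec h, c.ratio_spec h']

variable (X : Fin m → PowerCouple.{u}) (c : PowerSequence m)

/-- The disjoint union of the spaces `(X, A)^τ` for `τ ⊆ σ`. -/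
def Pieces (σ : Finset (Fin m)) : Type u := Σ τ : {τ : Finset (Fin m) // τ ⊆ σ}, polyObj X τ.1

instance (σ : Finset (Fin m)) : TopologicalSpace (Pieces X σ) :=
  inferInstanceAs (TopologicalSpace (Σ τ : {τ : Finset (Fin m) // τ ⊆ σ}, polyObj X τ.1))

/-- The gluing relation: for `μ ⊆ τ ⊆ σ`, a point `x` of `(X, A)^μ`, regarded as a point of
`(X, A)^τ`, is identified with the point `c^{τ/μ} x` of `(X, A)^μ`. -/
inductive Rel (σ : Finset (Fin m)) : Pieces X σ → Pieces X σ → Prop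
  | glue (μ τ : Finset (Fin m)) (h : μ ⊆ τ) (h' : τ ⊆ σ) (x : polyObj X μ) :
      Rel σ ⟨⟨τ, h'⟩, (polyFunctor X).map (homOfLE h) x⟩
        ⟨⟨μ, h.trans h'⟩, polyPow X (c.ratio τ μ) μ x⟩

/-- The quotient of the disjoint union by the gluing relation. -/
def wObj (σ : Finset (Fin m)) : TopCat.{u} := TopCat.of (Quot (Rel X c σ))

/-- The map from `(X, A)^τ` to the quotient. -/
def wι {τ σ : Finset (Fin m)} (h : τ ⊆ σ) : (polyFunctor X).obj τ ⟶ wObj X c σ :=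
  TopCat.ofHom ⟨fun x => Quot.mk _ ⟨⟨τ, h⟩, x⟩,
    continuous_quot_mk.comp (continuous_sigmaMk (σ := fun τ : {τ : Finset (Fin m) // τ ⊆ σ} =>
      polyObj X τ.1) (i := ⟨τ, h⟩))⟩

theorem wι_rel {μ τ σ : Finset (Fin m)} (h : μ ⊆ τ) (h' : τ ⊆ σ) :
    (polyFunctor X).map (homOfLE h) ≫ wι X c h' =
      polyPow X (c.ratio τ μ) μ ≫ wι X c (h.trans h') := by
  ext x
  exact Quot.sound (Rel.glue μ τ h h' x)

/-- The universal property of the quotient. -/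
def wDesc {σ : Finset (Fin m)} {Z : TopCat.{u}}
    (f : ∀ τ, τ ⊆ σ → ((polyFunctor X).obj τ ⟶ Z))
    (hf : ∀ μ τ (h : μ ⊆ τ) (h' : τ ⊆ σ), (polyFunctor X).map (homOfLE h) ≫ f τ h' =
      polyPow X (c.ratio τ μ) μ ≫ f μ (h.trans h')) : wObj X c σ ⟶ Z :=
  TopCat.ofHom ⟨Quot.lift (fun p : Pieces X σ => f p.1.1 p.1.2 p.2) (by
      rintro _ _ ⟨μ, τ, h, h', x⟩
      exact ConcreteCategory.congr_hom (hf μ τ h h') x),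
    continuous_quot_lift _ (continuous_sigma fun τ => (f τ.1 τ.2).hom.continuous)⟩

theorem wι_wDesc {σ : Finset (Fin m)} {Z : TopCat.{u}}
    (f : ∀ τ, τ ⊆ σ → ((polyFunctor X).obj τ ⟶ Z)) (hf) (τ) (h : τ ⊆ σ) :
    wι X c h ≫ wDesc X c f hf = f τ h := rfl

theorem w_ext {σ : Finset (Fin m)} {Z : TopCat.{u}} {f g : wObj X c σ ⟶ Z}
    (h : ∀ τ (h : τ ⊆ σ), wι X c h ≫ f = wι X c h ≫ g) : f = g := by
  ext x
  obtain ⟨⟨τ, x⟩, rfl⟩ := Quot.exists_rep x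
  exact ConcreteCategory.congr_hom (h τ.1 τ.2) x

/-- The quotients as a functor on the faces of the simplex. -/
def wFunctor : Finset (Fin m) ⥤ TopCat.{u} where
  obj := wObj X c
  map {τ σ} h := wDesc X c (fun μ h' => wι X c (h'.trans (leOfHom h)))
    (fun _ _ h₁ h₂ => wι_rel X c h₁ (h₂.trans (leOfHom h)))
  map_id σ := w_ext X c fun τ h => rfl
  map_comp f g := w_ext X c fun τ h => rfl

/-- The map from `(X, A)^τ` to the value of `wFunctor` at `σ`. -/
def wη {τ σ : Finset (Fin m)} (h : τ ⊆ σ) : (polyFunctor X).obj τ ⟶ (wFunctor X c).obj σ :=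
  wι X c h

theorem wη_rel {μ τ σ : Finset (Fin m)} (h : μ ⊆ τ) (h' : τ ⊆ σ) :
    (polyFunctor X).map (homOfLE h) ≫ wη X c h' =
      polyPow X (c.ratio τ μ) μ ≫ wη X c (h.trans h') := wι_rel X c h h'

/-- The universal property of the quotient. -/
def wD {σ : Finset (Fin m)} {Z : TopCat.{u}}
    (f : ∀ τ, τ ⊆ σ → ((polyFunctor X).obj τ ⟶ Z))
    (hf : ∀ μ τ (h : μ ⊆ τ) (h' : τ ⊆ σ), (polyFunctor X).map (homOfLE h) ≫ f τ h' =
      polyPow X (c.ratio τ μ) μ ≫ f μ (h.trans h')) : (wFunctor X c).obj σ ⟶ Z := wDesc X c f hf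

theorem wη_wD {σ : Finset (Fin m)} {Z : TopCat.{u}}
    (f : ∀ τ, τ ⊆ σ → ((polyFunctor X).obj τ ⟶ Z)) (hf) (τ) (h : τ ⊆ σ) :
    wη X c h ≫ wD X c f hf = f τ h := rfl

theorem wη_ext {σ : Finset (Fin m)} {Z : TopCat.{u}} {f g : (wFunctor X c).obj σ ⟶ Z}
    (h : ∀ τ (h : τ ⊆ σ), wη X c h ≫ f = wη X c h ≫ g) : f = g := w_ext X c h

theorem ssub {τ σ : Finset (Fin m)} (h : τ ⊆ σ) (e : ¬ τ = σ) : τ ⊂ σ :=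
  Finset.ssubset_iff_subset_ne.2 ⟨h, e⟩

theorem wη_map {μ τ σ : Finset (Fin m)} (h : μ ⊆ τ) (h' : τ ⟶ σ) :
    wη X c h ≫ (wFunctor X c).map h' = wη X c (h.trans (leOfHom h')) := rfl

theorem toBoundary_map (F : Finset (Fin m) ⥤ TopCat.{u}) (σ) (τ : ProperFace σ) :
   toBoundary F σ τ ≫ boundaryMap F σ = F.map (homOfLE τ.2.subset) :=
  colimit.ι_desc _ _

theorem toBoundary_w (F : Finset (Fin m) ⥤ TopCat.{u}) (σ) (τ μ : ProperFace σ) (h : μ.1 ⊆ τ.1) :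
   F.map (homOfLE h) ≫ toBoundary F σ τ = toBoundary F σ μ :=
  colimit.w (properFaces F σ) (homOfLE h : μ ⟶ τ)

theorem wηB_aux (σ) (μ τ : ProperFace σ) (h1 : μ.1 ⊆ τ.1) :
    (polyFunctor X).map (homOfLE h1) ≫ polyPow X (c.ratio σ τ.1) τ.1 ≫ wη X c subset_rfl ≫
      toBoundary (wFunctor X c) σ τ = (polyPow X (c.ratio σ μ.1) μ.1 ≫ wη X c subset_rfl ≫
      toBoundary (wFunctor X c) σ μ) ≫ 𝟙 _ := by
  have e2 := wη_rel X c h1 (subset_refl τ.1)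
  have e : wη X c (subset_refl μ.1) ≫ (wFunctor X c).map (homOfLE h1) = wη X c h1 := rfl
  rw [← Category.assoc, polyPow_incl, Category.assoc, reassoc_of% e2, ← Category.assoc,
    polyPow_comp X _ _ _ _ (ratio_mul c h1 τ.2.subset), ← e, Category.assoc, toBoundary_w,
    Category.comp_id]

/-- The map `η(∂σ)`. -/
noncomputable def wηB (σ) : boundary (polyFunctor X) σ ⟶ boundary (wFunctor X c) σ :=
  colimit.desc (properFaces (polyFunctor X) σ)
    { pt := boundary (wFunctor X c) σ
      ι :=
        { app := fun τ => polyPow X (c.ratio σ τ.1) τ.1 ≫ wη X c subset_rfl ≫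
            toBoundary (wFunctor X c) σ τ
          naturality := fun μ τ h => wηB_aux X c σ μ τ (leOfHom h) } }

theorem toB_wηB (σ) (τ : ProperFace σ) : toBoundary (polyFunctor X) σ τ ≫ wηB X c σ =
      polyPow X (c.ratio σ τ.1) τ.1 ≫ wη X c subset_rfl ≫ toBoundary (wFunctor X c) σ τ :=
  colimit.ι_desc _ _

theorem boundary_ext {F : Finset (Fin m) ⥤ TopCat.{u}} {σ} {Z : TopCat.{u}}
    {f g : boundary F σ ⟶ Z} (h : ∀ τ, toBoundary F σ τ ≫ f = toBoundary F σ τ ≫ g) : f = g :=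
  colimit.hom_ext h

theorem ratio_self (σ i) : c.ratio σ σ i = 1 := by
  apply mul_left_cancel (a := c.toFun σ i)
  rw [c.ratio_spec subset_rfl, mul_one]

theorem polyPow_one (σ) (a : Fin m → ℕ+) (h : ∀ i, a i = 1) : polyPow X a σ = 𝟙 _ := by
  ext x
  apply Subtype.ext
  funext i
  change ((X i).pow (a i)) (x.1 i) = x.1 i
  rw [h i, (X i).pow_one]
  rfl

open Classical in
theorem w_isPushout (σ : Finset (Fin m)) :
    IsPushout (boundaryMap (polyFunctor X) σ) (wηB X c σ) (wη X c subset_rfl)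
      (boundaryMap (wFunctor X c) σ) := by
  refine ⟨⟨boundary_ext fun τ => ?_⟩, ⟨PushoutCocone.IsColimit.mk _ (fun s => ?_) ?_ ?_ ?_⟩⟩
  · rw [← Category.assoc, toBoundary_map, ← Category.assoc, toB_wηB, Category.assoc,
      Category.assoc, toBoundary_map, wη_rel]
    rfl
  · refine wD X c (fun τ h => if e : τ = σ then eqToHom (by rw [e]) ≫ s.inl else
      wη X c subset_rfl ≫ toBoundary (wFunctor X c) σ ⟨τ, ssub h e⟩ ≫ s.inr) ?_
    intro μ τ h h'
    by_cases e : τ = σ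
    · subst e
      by_cases e' : μ = τ
      · subst e'
        rw [polyPow_one X _ _ (ratio_self c _)]
        simp
      · rw [dif_pos rfl, dif_neg e']
        have := s.condition
        have h2 := congrArg (fun k => toBoundary (polyFunctor X) τ ⟨μ, ssub h e'⟩ ≫ k) this
        simp only [← Category.assoc, toBoundary_map, toB_wηB] at h2
        simpa using h2
    · have e' : μ ≠ σ := fun e' => e (subset_antisymm h' (e' ▸ h))
      rw [dif_neg e, dif_neg e', ← Category.assoc, wη_rel, Category.assoc]
      congr 1
      rw [← toBoundary_w _ _ ⟨τ, ssub h' e⟩ ⟨μ, _⟩ h]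
      rfl
  · intro s
    rw [wη_wD]
    simp
  · intro s
    refine boundary_ext fun τ => ?_
    rw [← Category.assoc, toBoundary_map]
    refine wη_ext X c fun μ h => ?_
    have hlt : μ ⊂ σ := Finset.ssubset_of_subset_of_ssubset h τ.2
    rw [← Category.assoc, wη_map, wη_wD, dif_neg hlt.ne,
      ← toBoundary_w _ _ τ ⟨μ, hlt⟩ h]
    rfl
  · intro s k h1 h2
    refine wη_ext X c fun τ h => ?_
    rw [wη_wD]
    by_cases e : τ = σ
    · subst e
      simp [← h1]
    · rw [dif_neg e, ← h2, ← Category.assoc (toBoundary _ _ _), toBoundary_map]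
      rfl

/-- Weighted polyhedral product systems exist. -/
theorem nonempty : Nonempty (WeightedSystem X c) :=
  ⟨{ functor := wFunctor X c
     base := fun σ => wη X c subset_rfl (polyBase X σ)
     map_base := by
      intro τ σ h
      have := Rel.glue (c := c) τ σ (leOfHom h) subset_rfl (polyBase X τ)
      have e : polyPow X (c.ratio σ τ) τ (polyBase X τ) = polyBase X τ := by
        apply Subtype.ext
        funext i
        exact ((X i).isMapOfPairs_pow _).map_base
      rw [e] at this
      exact (Quot.sound this).symm
     η := fun σ => wη X c subset_rfl
     η_base := fun σ => rfl
     isIso_η_empty := by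
      have key : ∀ τ, τ ⊆ (∅ : Finset (Fin m)) → τ = ∅ := fun τ h => Finset.subset_empty.1 h
      refine ⟨wD X c (fun τ h => eqToHom (by rw [key τ h])) ?_, ?_, ?_⟩
      · intro μ τ h h'
        obtain rfl := key τ h'
        obtain rfl := key μ h
        rw [polyPow_one X _ _ (ratio_self c _)]
        rfl
      · rw [wη_wD]; rfl
      · refine wη_ext X c fun τ h => ?_
        obtain rfl := key τ h
        rw [← Category.assoc, wη_wD]
        rfl
     ηBoundary := wηB X c
     toBoundary_ηBoundary := fun σ τ => toB_wηB X c σ τ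
     isPushout := fun σ _ => w_isPushout X c σ }⟩

end WeightedSystem

/-! A map out of $(X,A)^{\sigma,c}$ amounts to maps $f_\tau$ out of the unweighted spaces
$(X,A)^\tau$, $\tau\subseteq\sigma$, such that $f_\tau$ restricted to $(X,A)^\mu$ is $f_\mu\circ
c^{\tau/\mu}$. This follows from the defining pushouts by induction on $\sigma$
(`WeightedSystem.obj_ext`, `WeightedSystem.exists_desc`). As the $\varphi_i$ commute with the power
maps, they induce such a family, which gives existence and uniqueness. The inverse of a
homeomorphism commutes with the power maps too, so homeomorphisms induce homeomorphisms.

A homotopy inverse of $\varphi_i$ need not commute with the power maps and induces nothing on the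
weighted spaces. Instead, adding a maximal face $\sigma$ to a complex attaches the unweighted
$(X,A)^\sigma$ along $(X,A)^{\partial\sigma}$, and the weights enter only through the attaching map
(`WeightedSystem.isPushout_attach`). On these unweighted spaces products of homotopy inverses are
available (`exists_polyMap_inverse`), and the gluing lemma `HE.glue` carries the equivalence from
complex to complex (`WeightedSystem.he_colimOnMap`).

The gluing lemma needs $(X,A)^{\partial\sigma}\to(X,A)^\sigma$ to be a cofibration. Cell attachments
make $A_i\subseteq X_i$ a closed cofibration; in the form of a Strøm structure this property passes
to products (`polyStromData`) and to compactly generated topologies. All inclusions between weighted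
spaces are then cofibrations, and equivalences of cofibrations are equivalences of pairs
(`HEP.exists_inverse_extending`). Since the basepoint need not be a cofibration, a pointed inverse
is chosen on the face $\emptyset$ and extended strictly.

Homotopies are maps into path spaces. They can therefore be defined on pushouts and colimits by the
universal property, without commuting colimits with products by the interval. -/

/-! ### Path objects and homotopies -/

namespace TopHtpy

open unitInterval

/-- The space of paths in `Z`. -/
abbrev Pth (Z : TopCat.{u}) : TopCat.{u} := TopCat.of C(I, Z)

/-- Evaluation of paths at time `t`. -/
def ev (Z : TopCat.{u}) (t : I) : Pth Z ⟶ Z :=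
  TopCat.ofHom ⟨fun w => w t, ContinuousEvalConst.continuous_eval_const t⟩

/-- The constant paths. -/
def cst (Z : TopCat.{u}) : Z ⟶ Pth Z :=
  TopCat.ofHom ⟨fun z => ContinuousMap.const I z, ContinuousMap.continuous_const'⟩

/-- The map on path spaces induced by a map. -/
def pmap {Y Z : TopCat.{u}} (f : Y ⟶ Z) : Pth Y ⟶ Pth Z :=
  TopCat.ofHom ⟨fun w => f.hom.comp w, ContinuousMap.continuous_postcomp f.hom⟩

/-- Reparametrization of paths. -/
def repar (Z : TopCat.{u}) (r : C(I, I)) : Pth Z ⟶ Pth Z :=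
  TopCat.ofHom ⟨fun w => w.comp r, ContinuousMap.continuous_precomp r⟩

theorem cst_ev (Z : TopCat.{u}) (t : I) : cst Z ≫ ev Z t = 𝟙 Z := rfl

theorem pmap_ev {Y Z : TopCat.{u}} (f : Y ⟶ Z) (t : I) : pmap f ≫ ev Z t = ev Y t ≫ f := rfl

theorem cst_pmap {Y Z : TopCat.{u}} (f : Y ⟶ Z) : cst Y ≫ pmap f = f ≫ cst Z := rfl

theorem pmap_comp {X Y Z : TopCat.{u}} (f : X ⟶ Y) (g : Y ⟶ Z) :
    pmap (f ≫ g) = pmap f ≫ pmap g := rfl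

/-- A map into a path space from a function of two variables. -/
def curryPth {X Z : TopCat.{u}} (F : X × I → Z) (hF : Continuous F) : X ⟶ Pth Z :=
  TopCat.ofHom (ContinuousMap.curry ⟨F, hF⟩)

theorem continuous_uncurryPth {X Z : TopCat.{u}} (h : X ⟶ Pth Z) :
    Continuous fun p : X × I => (h p.1 : C(I, Z)) p.2 :=
  ContinuousMap.continuous_uncurry_of_continuous h.hom

/-- The first half of the unit interval, stretched. -/
noncomputable def firstHalf : C(I, I) :=
  ⟨fun s => Set.projIcc 0 1 zero_le_one (2 * (s : ℝ)), by fun_prop⟩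

/-- The second half of the unit interval, stretched. -/
noncomputable def secondHalf : C(I, I) :=
  ⟨fun s => Set.projIcc 0 1 zero_le_one (2 * (s : ℝ) - 1), by fun_prop⟩

theorem firstHalf_half {s : I} (h : (s : ℝ) = 1 / 2) : firstHalf s = 1 := by
  apply Subtype.ext
  simp [firstHalf, h, Set.projIcc]

theorem secondHalf_half {s : I} (h : (s : ℝ) = 1 / 2) : secondHalf s = 0 := by
  apply Subtype.ext
  simp [secondHalf, h, Set.projIcc]

theorem firstHalf_zero : firstHalf 0 = 0 := by
  apply Subtype.ext
  simp [firstHalf, Set.projIcc]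

theorem secondHalf_one : secondHalf 1 = 1 := by
  apply Subtype.ext
  norm_num [secondHalf, Set.projIcc]

/-- Concatenation of homotopies. -/
noncomputable def cat {X Z : TopCat.{u}} (h k : X ⟶ Pth Z) (e : h ≫ ev Z 1 = k ≫ ev Z 0) :
    X ⟶ Pth Z :=
  curryPth (fun p => if (p.2 : ℝ) ≤ 1 / 2 then (h p.1 : C(I, Z)) (firstHalf p.2)
      else (k p.1 : C(I, Z)) (secondHalf p.2)) (by
    refine Continuous.if_le ?_ ?_ (by fun_prop) (by fun_prop) ?_
    · exact (continuous_uncurryPth h).comp (by fun_prop : Continuous fun p : X × I =>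
        (p.1, firstHalf p.2))
    · exact (continuous_uncurryPth k).comp (by fun_prop : Continuous fun p : X × I =>
        (p.1, secondHalf p.2))
    · intro p hp
      rw [firstHalf_half hp, secondHalf_half hp]
      exact ConcreteCategory.congr_hom e p.1)

theorem cat_ev_zero {X Z : TopCat.{u}} (h k : X ⟶ Pth Z) (e) :
    cat h k e ≫ ev Z 0 = h ≫ ev Z 0 := by
  ext x
  change (if ((0 : I) : ℝ) ≤ 1 / 2 then (h x : C(I, Z)) (firstHalf 0) else _) = _
  rw [if_pos (by norm_num), firstHalf_zero]
  rfl

theorem cat_ev_one {X Z : TopCat.{u}} (h k : X ⟶ Pth Z) (e) :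
    cat h k e ≫ ev Z 1 = k ≫ ev Z 1 := by
  ext x
  change (if ((1 : I) : ℝ) ≤ 1 / 2 then _ else (k x : C(I, Z)) (secondHalf 1)) = _
  rw [if_neg (by norm_num), secondHalf_one]
  rfl

theorem comp_cat {A X Z : TopCat.{u}} (a : A ⟶ X) (h k : X ⟶ Pth Z) (e) :
    a ≫ cat h k e = cat (a ≫ h) (a ≫ k) (by simp only [Category.assoc, e]) := rfl

theorem cat_pmap {X Y Z : TopCat.{u}} (h k : X ⟶ Pth Y) (e) (f : Y ⟶ Z) :
    cat h k e ≫ pmap f = cat (h ≫ pmap f) (k ≫ pmap f)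
      (by simp only [Category.assoc, pmap_ev, reassoc_of% e]) := by
  ext x s
  exact apply_ite f _ _ _

theorem cat_cst {X Z : TopCat.{u}} (f : X ⟶ Z) (e) : cat (f ≫ cst Z) (f ≫ cst Z) e = f ≫ cst Z := by
  ext x s
  exact ite_self _

theorem cat_congr {X Z : TopCat.{u}} {h h' k k' : X ⟶ Pth Z} (e) (e₁ : h = h') (e₂ : k = k') :
    cat h k e = cat h' k' (by rw [← e₁, ← e₂, e]) := by
  subst e₁ e₂
  rfl

/-- Reversal of paths. -/
noncomputable def rev (Z : TopCat.{u}) : Pth Z ⟶ Pth Z := repar Z ⟨σ, continuous_symm⟩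

theorem rev_ev_zero (Z : TopCat.{u}) : rev Z ≫ ev Z 0 = ev Z 1 := by
  ext w
  change w (σ 0) = w 1
  rw [symm_zero]

theorem rev_ev_one (Z : TopCat.{u}) : rev Z ≫ ev Z 1 = ev Z 0 := by
  ext w
  change w (σ 1) = w 0
  rw [symm_one]

theorem cst_rev (Z : TopCat.{u}) : cst Z ≫ rev Z = cst Z := rfl

theorem rev_pmap {Y Z : TopCat.{u}} (f : Y ⟶ Z) : rev Y ≫ pmap f = pmap f ≫ rev Z := rfl

/-- The paths `s ↦ w (max |2s - 1| t)`, which contract the path `w⁻¹ * w` to a constant path. -/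
noncomputable def foldBack (Z : TopCat.{u}) : Pth Z ⟶ Pth (Pth Z) :=
  TopCat.ofHom ⟨fun w => (w.comp ⟨fun p : I × I => max p.1
      (Set.projIcc 0 1 zero_le_one |2 * (p.2 : ℝ) - 1|), by fun_prop⟩).curry, by
    refine ContinuousMap.continuous_of_continuous_uncurry _ ?_
    refine ContinuousMap.continuous_of_continuous_uncurry _ ?_
    exact continuous_eval.comp (X := (C(I, Z) × I) × I) (Y := C(I, Z) × I)
      (f := fun p => (p.1.1, max p.1.2 (Set.projIcc 0 1 zero_le_one |2 * (p.2 : ℝ) - 1|)))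
      (by fun_prop)⟩

/-- The maximum of `t` and `|2s - 1|` is `1` as soon as `t = 1`, `s = 0` or `s = 1`. Three sides of
the square are thus constant at the end of `w`, as this lemma and the next two record. -/
theorem foldBack_ev_one (Z : TopCat.{u}) : foldBack Z ≫ ev (Pth Z) 1 = ev Z 1 ≫ cst Z := by
  ext w s
  exact congrArg (w : C(I, Z)) (max_eq_left le_one')

theorem foldBack_pmap_zero (Z : TopCat.{u}) : foldBack Z ≫ pmap (ev Z 0) = ev Z 1 ≫ cst Z := by
  ext w t
  refine congrArg (w : C(I, Z)) ?_
  apply Subtype.ext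
  simp [Set.projIcc, t.2.2]

theorem foldBack_pmap_one (Z : TopCat.{u}) : foldBack Z ≫ pmap (ev Z 1) = ev Z 1 ≫ cst Z := by
  ext w t
  refine congrArg (w : C(I, Z)) ?_
  apply Subtype.ext
  norm_num [Set.projIcc, t.2.2]

/-- The fourth side is `s ↦ w |2s - 1|`, which runs `w` backwards and then forwards. -/
theorem foldBack_ev_zero (Z : TopCat.{u}) : foldBack Z ≫ ev (Pth Z) 0 =
    cat (rev Z) (𝟙 _) (by rw [rev_ev_one, Category.id_comp]) := by
  ext w s
  change w (max 0 (Set.projIcc 0 1 zero_le_one |2 * (s : ℝ) - 1|)) =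
    if (s : ℝ) ≤ 1 / 2 then w (σ (firstHalf s)) else w (secondHalf s)
  have h0 := s.2.1
  have h1 := s.2.2
  split_ifs with h
  · congr 1
    apply Subtype.ext
    have e1 : |2 * (s : ℝ) - 1| = 1 - 2 * s := by rw [abs_of_nonpos (by linarith)]; ring
    simp only [firstHalf, e1, Set.projIcc, ContinuousMap.coe_mk, coe_symm_eq]
    rw [max_eq_right nonneg']
    simp only [min_eq_right (by linarith : 2 * (s : ℝ) ≤ 1),
      min_eq_right (by linarith : 1 - 2 * (s : ℝ) ≤ 1),
      max_eq_right (by linarith : (0 : ℝ) ≤ 2 * s),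
      max_eq_right (by linarith : (0 : ℝ) ≤ 1 - 2 * s)]
  · congr 1
    have e1 : |2 * (s : ℝ) - 1| = 2 * s - 1 := abs_of_nonneg (by linarith)
    rw [e1]
    exact max_eq_right nonneg'

/-! ### Homotopy extension, relative homotopy and homotopy equivalences. -/

/-- The homotopy extension property. -/
def HEP {A X : TopCat.{u}} (i : A ⟶ X) : Prop :=
  ∀ (Z : TopCat.{u}) (f : X ⟶ Z) (h : A ⟶ Pth Z), h ≫ ev Z 0 = i ≫ f →
    ∃ H : X ⟶ Pth Z, H ≫ ev Z 0 = f ∧ i ≫ H = h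

/-- Homotopy relative to a map `i : A ⟶ X`. -/
def HRel {A X Z : TopCat.{u}} (i : A ⟶ X) (f g : X ⟶ Z) : Prop :=
  ∃ h : X ⟶ Pth Z, h ≫ ev Z 0 = f ∧ h ≫ ev Z 1 = g ∧ i ≫ h = i ≫ f ≫ cst Z

/-- Homotopy of maps. -/
def Htp : HomRel TopCat.{u} := fun _ Z f g => ∃ h, h ≫ ev Z 0 = f ∧ h ≫ ev Z 1 = g

theorem HRel.htp {A X Z : TopCat.{u}} {i : A ⟶ X} {f g : X ⟶ Z} (h : HRel i f g) : Htp f g :=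
  let ⟨k, h₀, h₁, _⟩ := h
  ⟨k, h₀, h₁⟩

theorem HRel.comp_eq {A X Z : TopCat.{u}} {i : A ⟶ X} {f g : X ⟶ Z} (h : HRel i f g) :
    i ≫ f = i ≫ g := by
  obtain ⟨k, rfl, rfl, h⟩ := h
  have := h =≫ ev Z 1
  simpa only [Category.assoc, cst_ev, Category.comp_id] using this.symm

theorem HRel.symm {A X Z : TopCat.{u}} {i : A ⟶ X} {f g : X ⟶ Z} (h : HRel i f g) :
    HRel i g f := by
  have e := h.comp_eq
  obtain ⟨k, h₀, h₁, h₂⟩ := h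
  refine ⟨k ≫ rev Z, by rw [Category.assoc, rev_ev_zero, h₁],
    by rw [Category.assoc, rev_ev_one, h₀], ?_⟩
  rw [reassoc_of% h₂, cst_rev, reassoc_of% e]

theorem HRel.trans {A X Z : TopCat.{u}} {i : A ⟶ X} {f g k : X ⟶ Z} (h : HRel i f g)
    (h' : HRel i g k) : HRel i f k := by
  have e := h.comp_eq
  obtain ⟨p, h₀, h₁, h₂⟩ := h
  obtain ⟨q, h₀', h₁', h₂'⟩ := h'
  have e₁ : i ≫ p = (i ≫ f) ≫ cst Z := by rw [h₂, Category.assoc]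
  have e₂ : i ≫ q = (i ≫ f) ≫ cst Z := by rw [h₂', e, Category.assoc]
  refine ⟨cat p q (h₁.trans h₀'.symm), by rw [cat_ev_zero, h₀], by rw [cat_ev_one, h₁'], ?_⟩
  rw [comp_cat, cat_congr _ e₁ e₂, cat_cst, Category.assoc]

theorem HRel.comp_right {A X Y Z : TopCat.{u}} {i : A ⟶ X} {f g : X ⟶ Y} (h : HRel i f g)
    (k : Y ⟶ Z) : HRel i (f ≫ k) (g ≫ k) := by
  obtain ⟨p, rfl, rfl, h₂⟩ := h
  refine ⟨p ≫ pmap k, rfl, rfl, ?_⟩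
  rw [reassoc_of% h₂]
  rfl

theorem HRel.comp_left {A B X Y Z : TopCat.{u}} {i : A ⟶ X} {j : B ⟶ Y} {f g : Y ⟶ Z}
    (h : HRel j f g) (k : X ⟶ Y) (l : A ⟶ B) (e : i ≫ k = l ≫ j) :
    HRel i (k ≫ f) (k ≫ g) := by
  obtain ⟨p, rfl, rfl, h₂⟩ := h
  refine ⟨k ≫ p, rfl, rfl, ?_⟩
  simp only [Category.assoc] at h₂ ⊢
  rw [reassoc_of% e, h₂, reassoc_of% e]

theorem Htp.refl {X Z : TopCat.{u}} (f : X ⟶ Z) : Htp f f := ⟨f ≫ cst Z, rfl, rfl⟩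

theorem Htp.symm {X Z : TopCat.{u}} {f g : X ⟶ Z} (h : Htp f g) : Htp g f := by
  obtain ⟨k, h₀, h₁⟩ := h
  exact ⟨k ≫ rev Z, by rw [Category.assoc, rev_ev_zero, h₁],
    by rw [Category.assoc, rev_ev_one, h₀]⟩

theorem Htp.trans {X Z : TopCat.{u}} {f g k : X ⟶ Z} (h : Htp f g) (h' : Htp g k) : Htp f k := by
  obtain ⟨p, h₀, h₁⟩ := h
  obtain ⟨q, h₀', h₁'⟩ := h'
  exact ⟨cat p q (h₁.trans h₀'.symm), by rw [cat_ev_zero, h₀], by rw [cat_ev_one, h₁']⟩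

theorem Htp.comp_right {X Y Z : TopCat.{u}} {f g : X ⟶ Y} (h : Htp f g) (k : Y ⟶ Z) :
    Htp (f ≫ k) (g ≫ k) := by
  obtain ⟨p, rfl, rfl⟩ := h
  exact ⟨p ≫ pmap k, rfl, rfl⟩

theorem Htp.comp_left {X Y Z : TopCat.{u}} {f g : Y ⟶ Z} (h : Htp f g) (k : X ⟶ Y) :
    Htp (k ≫ f) (k ≫ g) := by
  obtain ⟨p, rfl, rfl⟩ := h
  exact ⟨k ≫ p, rfl, rfl⟩

instance : Congruence Htp.{u} where
  equivalence := ⟨Htp.refl, Htp.symm, Htp.trans⟩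
  comp_left f _ _ h := h.comp_left f
  comp_right g h := h.comp_right g

/-- The functor from spaces to the naive homotopy category. -/
abbrev ho : TopCat.{u} ⥤ CategoryTheory.Quotient Htp.{u} := CategoryTheory.Quotient.functor Htp

theorem ho_eq_iff {X Z : TopCat.{u}} {f g : X ⟶ Z} : ho.map f = ho.map g ↔ Htp f g :=
  CategoryTheory.Quotient.functor_map_eq_iff Htp f g

/-- Homotopy equivalences. -/
def HE {X Y : TopCat.{u}} (f : X ⟶ Y) : Prop :=
  ∃ g : Y ⟶ X, Htp (𝟙 X) (f ≫ g) ∧ Htp (𝟙 Y) (g ≫ f)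

theorem he_iff_isIso {X Y : TopCat.{u}} (f : X ⟶ Y) : HE f ↔ IsIso (ho.map f) := by
  constructor
  · rintro ⟨g, h, k⟩
    exact ⟨ho.map g, by rw [← ho.map_comp, ← ho.map_id, ho_eq_iff.2 h],
      by rw [← ho.map_comp, ← ho.map_id, ho_eq_iff.2 k]⟩
  · rintro ⟨g, h, k⟩
    obtain ⟨g, rfl⟩ := ho.map_surjective g
    rw [← ho.map_comp, ← ho.map_id] at h k
    exact ⟨g, ho_eq_iff.1 h.symm, ho_eq_iff.1 k.symm⟩

theorem HE.comp {X Y Z : TopCat.{u}} {f : X ⟶ Y} {g : Y ⟶ Z} (hf : HE f) (hg : HE g) :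
    HE (f ≫ g) := by
  rw [he_iff_isIso] at *
  rw [ho.map_comp]
  infer_instance

theorem HE.of_comp_left {X Y Z : TopCat.{u}} {f : X ⟶ Y} {g : Y ⟶ Z} (hf : HE f)
    (h : HE (f ≫ g)) : HE g := by
  rw [he_iff_isIso] at *
  rw [ho.map_comp] at h
  exact IsIso.of_isIso_comp_left (ho.map f) (ho.map g)

theorem HE.of_comp_right {X Y Z : TopCat.{u}} {f : X ⟶ Y} {g : Y ⟶ Z} (hg : HE g)
    (h : HE (f ≫ g)) : HE f := by
  rw [he_iff_isIso] at *
  rw [ho.map_comp] at h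
  exact IsIso.of_isIso_comp_right (ho.map f) (ho.map g)

theorem HE.of_htp {X Y : TopCat.{u}} {f g : X ⟶ Y} (hf : HE f) (h : Htp f g) : HE g := by
  rw [he_iff_isIso] at *
  rwa [← ho_eq_iff.2 h]

theorem HE.of_isIso {X Y : TopCat.{u}} (f : X ⟶ Y) [IsIso f] : HE f := by
  rw [he_iff_isIso]
  infer_instance

/-! ### Homotopy extension and maps under a space -/

/-- Extensions of homotopies are unique up to homotopy. -/
theorem HEP.unique {A X Z : TopCat.{u}} {i : A ⟶ X} (hi : HEP i) {h k : X ⟶ Pth Z}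
    (e : i ≫ h = i ≫ k) (e₀ : h ≫ ev Z 0 = k ≫ ev Z 0) : HRel i (h ≫ ev Z 1) (k ≫ ev Z 1) := by
  have e₁ : (h ≫ rev Z) ≫ ev Z 1 = k ≫ ev Z 0 := by rw [Category.assoc, rev_ev_one, e₀]
  -- `P` runs back along `h` and then forward along `k`, so it joins the two ends in question. Over
  -- `A` it has the form `w⁻¹ * w`, which `foldBack` contracts. Homotopy extension with target `Pth
  -- Z` spreads this contraction to a square `H` over `X` with `P` as one side.
  let P := cat (h ≫ rev Z) k e₁
  have hP : (i ≫ h ≫ foldBack Z) ≫ ev _ 0 = i ≫ P := by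
    rw [Category.assoc, Category.assoc, foldBack_ev_zero, comp_cat, comp_cat, comp_cat]
    exact cat_congr _ rfl (by rw [Category.comp_id, e])
  obtain ⟨H, H₀, H₁⟩ := hi _ P _ hP
  have ends (p : Pth (Pth Z) ⟶ Pth Z) (hp : foldBack Z ≫ p = ev Z 1 ≫ cst Z) :
      i ≫ H ≫ p = i ≫ h ≫ ev Z 1 ≫ cst Z := by
    rw [reassoc_of% H₁, hp]
  have r (p : Pth (Pth Z) ⟶ Pth Z) (hp : foldBack Z ≫ p = ev Z 1 ≫ cst Z) :
      HRel i (H ≫ p ≫ ev Z 0) (H ≫ p ≫ ev Z 1) := by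
    refine ⟨H ≫ p, rfl, rfl, ?_⟩
    rw [ends p hp]
    have := ends p hp =≫ ev Z 0
    simp only [Category.assoc, cst_ev, Category.comp_id] at this
    rw [← Category.assoc i (H ≫ p ≫ ev Z 0)]
    simp only [Category.assoc]
    rw [reassoc_of% this]
  -- The other three sides of the square lead from the end of `h` to the end of `k`, and each is
  -- constant over `A`.
  have a := (r _ (foldBack_pmap_zero Z)).trans ((r _ (foldBack_ev_one Z)).trans
    (r _ (foldBack_pmap_one Z)).symm)
  have b₀ : H ≫ pmap (ev Z 0) ≫ ev Z 0 = h ≫ ev Z 1 := by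
    change (H ≫ ev _ 0) ≫ ev Z 0 = _
    rw [H₀, cat_ev_zero, Category.assoc, rev_ev_zero]
  have b₁ : H ≫ pmap (ev Z 1) ≫ ev Z 0 = k ≫ ev Z 1 := by
    change (H ≫ ev _ 0) ≫ ev Z 1 = _
    rw [H₀, cat_ev_one]
  rwa [b₀, b₁] at a

/-- A map under `A` that is homotopic to the identity has a left inverse relative to `A`. -/
theorem HEP.exists_left_inverse {A X : TopCat.{u}} {i : A ⟶ X} (hi : HEP i) {φ : X ⟶ X}
    (hφ : i ≫ φ = i) (h : Htp φ (𝟙 X)) : ∃ ψ : X ⟶ X, i ≫ ψ = i ∧ HRel i (φ ≫ ψ) (𝟙 X) := by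
  obtain ⟨F, F₀, F₁⟩ := h
  -- Over `A` the homotopy `F` goes from `i` to `i`, so it extends to a homotopy `G` of the
  -- identity, whose end is `ψ`. Now `φ ≫ G` and `F` both start at `φ` and agree over `A`, and
  -- `HEP.unique` compares their ends.
  obtain ⟨G, G₀, G₁⟩ := hi X (𝟙 X) (i ≫ F) (by rw [Category.assoc, F₀, hφ, Category.comp_id])
  refine ⟨G ≫ ev X 1, by rw [reassoc_of% G₁, F₁, Category.comp_id], ?_⟩
  have := hi.unique (h := φ ≫ G) (k := F) (by rw [reassoc_of% hφ, G₁])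
    (by rw [Category.assoc, G₀, F₀, Category.comp_id])
  rwa [F₁, Category.assoc] at this

/-- A homotopy equivalence under `A` has a left inverse relative to `A`. -/
theorem HEP.exists_left_inverse_of_he {A X Y : TopCat.{u}} {i : A ⟶ X} {j : A ⟶ Y} (hi : HEP i)
    (hj : HEP j) {f : X ⟶ Y} (hf : i ≫ f = j) (h : HE f) :
    ∃ g : Y ⟶ X, j ≫ g = i ∧ HRel i (f ≫ g) (𝟙 X) := by
  obtain ⟨g, ⟨H, H₀, H₁⟩, -⟩ := h
  -- Over `A` the reversed homotopy moves `j ≫ g` to `i`; extending it deforms `g` into a map under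
  -- `A`.
  obtain ⟨G, G₀, G₁⟩ := hj X g (i ≫ H ≫ rev X) (by
    rw [Category.assoc, Category.assoc, rev_ev_zero, H₁, reassoc_of% hf])
  have e : j ≫ G ≫ ev X 1 = i := by
    rw [reassoc_of% G₁, rev_ev_one, H₀, Category.comp_id]
  obtain ⟨ψ, hψ, r⟩ := hi.exists_left_inverse (φ := f ≫ G ≫ ev X 1) (by rw [reassoc_of% hf, e])
    (by
      have a : Htp (f ≫ g) (f ≫ G ≫ ev X 1) := Htp.comp_left ⟨G, G₀, rfl⟩ f
      exact a.symm.trans (Htp.symm ⟨H, H₀, H₁⟩))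
  exact ⟨(G ≫ ev X 1) ≫ ψ, by rw [← Category.assoc, e, hψ], by simpa using r⟩

/-- A homotopy equivalence between cofibrations under `A` is a homotopy equivalence
relative to `A`. -/
theorem HEP.exists_inverse_of_he {A X Y : TopCat.{u}} {i : A ⟶ X} {j : A ⟶ Y} (hi : HEP i)
    (hj : HEP j) {f : X ⟶ Y} (hf : i ≫ f = j) (h : HE f) :
    ∃ g : Y ⟶ X, j ≫ g = i ∧ HRel i (f ≫ g) (𝟙 X) ∧ HRel j (g ≫ f) (𝟙 Y) := by
  obtain ⟨g, hg, r⟩ := hi.exists_left_inverse_of_he hj hf h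
  have hg' : HE g := h.of_comp_left ((HE.of_isIso (𝟙 X)).of_htp r.htp.symm)
  -- The left inverse `g` has a left inverse `f'` in turn, and relative to `A` one has `g ≫ f ≃ g ≫
  -- f ≫ g ≫ f' ≃ g ≫ f' ≃ 𝟙`.
  obtain ⟨f', hf', r'⟩ := hj.exists_left_inverse_of_he hi hg hg'
  refine ⟨g, hg, r, ?_⟩
  have a : HRel j (g ≫ f) (g ≫ f ≫ g ≫ f') := by
    have := (r'.symm).comp_left (i := j) (g ≫ f) (𝟙 A) (by rw [reassoc_of% hg, hf]; simp)
    simpa using this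
  have b : HRel j (g ≫ f ≫ g ≫ f') (g ≫ f') := by
    have := (r.comp_right f').comp_left (i := j) g (𝟙 A) (by simp [hg])
    simpa using this
  exact a.trans (b.trans r')


/-! ### Pushouts along cofibrations -/

theorem HEP.of_isIso {A X : TopCat.{u}} (i : A ⟶ X) [IsIso i] : HEP i := fun Z f h e =>
  ⟨inv i ≫ h, by rw [Category.assoc, e, IsIso.inv_hom_id_assoc], by simp⟩

theorem HEP.comp {A X Y : TopCat.{u}} {i : A ⟶ X} {j : X ⟶ Y} (hi : HEP i) (hj : HEP j) :
    HEP (i ≫ j) := fun Z f h e => by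
  obtain ⟨H, H₀, H₁⟩ := hi Z (j ≫ f) h (by rw [e, Category.assoc])
  obtain ⟨K, K₀, K₁⟩ := hj Z f H H₀
  exact ⟨K, K₀, by rw [Category.assoc, K₁, H₁]⟩

section Pushout

variable {A X C P : TopCat.{u}} {i : A ⟶ X} {k : A ⟶ C} {a : X ⟶ P} {b : C ⟶ P}

theorem HEP.pushout (hi : HEP i) (sq : IsPushout i k a b) : HEP b := fun Z f h e => by
  obtain ⟨H, H₀, H₁⟩ := hi Z (a ≫ f) (k ≫ h) (by
    rw [Category.assoc, e, reassoc_of% sq.w])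
  refine ⟨sq.desc H h H₁, sq.hom_ext ?_ ?_, sq.inr_desc _ _ _⟩
  · rw [sq.inl_desc_assoc, H₀]
  · rw [sq.inr_desc_assoc, e]

/-- A cofibration that is a homotopy equivalence remains a homotopy equivalence after a
pushout. -/
theorem HE.pushout_of_hep (hk : HE k) (hk' : HEP k) (sq : IsPushout i k a b) : HE a := by
  -- Viewing `k` as a map under `A` from `𝟙 A` to `k` makes `A` a strong deformation retract of `C`.
  -- The deformation is constant on `A`, so it glues with the constant homotopy on `X`.
  obtain ⟨r, hr, -, h⟩ := (HEP.of_isIso (𝟙 A)).exists_inverse_of_he hk' (Category.id_comp k) hk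
  obtain ⟨h, h₀, h₁, h₂⟩ := h.symm
  have e : i ≫ a ≫ cst P = k ≫ h ≫ pmap b := by
    rw [reassoc_of% h₂, cst_pmap, reassoc_of% sq.w]
  refine ⟨sq.desc (𝟙 X) (r ≫ i) (by rw [reassoc_of% hr, Category.comp_id]), ?_,
    sq.desc (a ≫ cst P) (h ≫ pmap b) e, sq.hom_ext ?_ ?_, sq.hom_ext ?_ ?_⟩
  · rw [sq.inl_desc]
    exact Htp.refl _
  · rw [sq.inl_desc_assoc, Category.assoc, cst_ev]
  · rw [sq.inr_desc_assoc, Category.assoc, pmap_ev, reassoc_of% h₀, Category.comp_id]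
  · rw [sq.inl_desc_assoc, sq.inl_desc_assoc, Category.assoc, cst_ev, Category.id_comp,
      Category.comp_id]
  · rw [sq.inr_desc_assoc, sq.inr_desc_assoc, Category.assoc, pmap_ev, reassoc_of% h₁,
      Category.assoc, sq.w]

/-- A retraction with a section that is a fibrewise homotopy inverse remains a homotopy
equivalence after a pushout along a cofibration. -/
theorem HE.pushout_of_retraction {s : C ⟶ A} (hs : s ≫ k = 𝟙 C) {D : A ⟶ Pth A}
    (D₀ : D ≫ ev A 0 = 𝟙 A) (D₁ : D ≫ ev A 1 = k ≫ s) (D₂ : D ≫ pmap k = k ≫ cst C)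
    (hi : HEP i) (sq : IsPushout i k a b) : HE a := by
  -- The inverse is the end of `H` on `X` and `s ≫ i` on `C`. Because `D` is fibrewise over `C`, the
  -- homotopy `H` followed by `a` agrees on `A` with the constant homotopy on `C`.
  obtain ⟨H, H₀, H₁⟩ := hi X (𝟙 X) (D ≫ pmap i) (by
    rw [Category.assoc, pmap_ev, reassoc_of% D₀, Category.comp_id])
  have e : i ≫ H ≫ pmap a = k ≫ b ≫ cst P := by
    rw [reassoc_of% H₁, ← pmap_comp, sq.w, pmap_comp, reassoc_of% D₂, cst_pmap]
  refine ⟨sq.desc (H ≫ ev X 1) (s ≫ i) ?_, ⟨H, H₀, by rw [sq.inl_desc]⟩,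
    sq.desc (H ≫ pmap a) (b ≫ cst P) e, sq.hom_ext ?_ ?_, sq.hom_ext ?_ ?_⟩
  · rw [reassoc_of% H₁, pmap_ev, reassoc_of% D₁]
  · rw [sq.inl_desc_assoc, Category.assoc, pmap_ev, reassoc_of% H₀, Category.comp_id]
  · rw [sq.inr_desc_assoc, Category.assoc, cst_ev]
  · rw [sq.inl_desc_assoc, sq.inl_desc_assoc, Category.assoc, pmap_ev, Category.assoc]
  · rw [sq.inr_desc_assoc, sq.inr_desc_assoc, Category.assoc, cst_ev, Category.assoc, sq.w,
      reassoc_of% hs, Category.comp_id]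

end Pushout

/-! ### Mapping cylinders -/

/-- The cylinder. -/
abbrev Cyl (A : TopCat.{u}) : TopCat.{u} := TopCat.of (A × I)

/-- The inclusion of the cylinder at time `t`. -/
def cylAt (A : TopCat.{u}) (t : I) : A ⟶ Cyl A := TopCat.ofHom ⟨fun x => (x, t), by fun_prop⟩

/-- The projection of the cylinder. -/
def cylProj (A : TopCat.{u}) : Cyl A ⟶ A := TopCat.ofHom ⟨Prod.fst, continuous_fst⟩

/-- The map of the cylinder that scales the interval by `t`. -/
def cylContract (A : TopCat.{u}) : Cyl A ⟶ Pth (Cyl A) :=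
  curryPth (fun p => (p.1.1, p.1.2 * σ p.2)) (by fun_prop)

/-- Slides of the cylinder coordinate along a path defined on the concatenated interval. -/
noncomputable def cylSlide {A Z : TopCat.{u}} (w : A ⟶ Pth Z) : Cyl A ⟶ Pth Z :=
  curryPth (fun p => (w p.1.1 : C(I, Z))
      (Set.projIcc 0 1 zero_le_one ((p.1.2 : ℝ) * (1 + (p.2 : ℝ)) / 2))) (by
    exact (continuous_uncurryPth w).comp (by fun_prop : Continuous fun p : (A × I) × I =>
        (p.1.1, Set.projIcc 0 1 zero_le_one ((p.1.2 : ℝ) * (1 + (p.2 : ℝ)) / 2))))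

/-- The cylinder on `A`, as a homotopy on `A`. -/
def cylPth (A : TopCat.{u}) : A ⟶ Pth (Cyl A) := curryPth (fun p => p) continuous_id

/-- Every map factors as a cofibration followed by a retraction with a section that is
a fibrewise homotopy inverse. -/
theorem exists_mapping_cylinder {A C : TopCat.{u}} (k : A ⟶ C) :
    ∃ (M : TopCat.{u}) (j : A ⟶ M) (r : M ⟶ C) (s : C ⟶ M) (D : M ⟶ Pth M),
      HEP j ∧ j ≫ r = k ∧ s ≫ r = 𝟙 C ∧ D ≫ ev M 0 = 𝟙 M ∧ D ≫ ev M 1 = r ≫ s ∧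
        D ≫ pmap r = r ≫ cst C := by
  let M := pushout (cylAt A 0) k
  let a : Cyl A ⟶ M := pushout.inl _ _
  let s : C ⟶ M := pushout.inr _ _
  have sq : IsPushout (cylAt A 0) k a s := IsPushout.of_hasPushout _ _
  let r : M ⟶ C := sq.desc (cylProj A ≫ k) (𝟙 C) rfl
  have ar : a ≫ r = cylProj A ≫ k := sq.inl_desc _ _ _
  have sr : s ≫ r = 𝟙 C := sq.inr_desc _ _ _
  have contract₀ : cylContract A ≫ ev _ 0 = 𝟙 (Cyl A) := by
    refine TopCat.ext fun p => Prod.ext rfl ?_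
    change p.2 * σ 0 = p.2
    rw [symm_zero, mul_one]
  have contract₁ : cylContract A ≫ ev _ 1 = cylProj A ≫ cylAt A 0 := by
    refine TopCat.ext fun p => Prod.ext rfl ?_
    change p.2 * σ 1 = 0
    rw [symm_one, mul_zero]
  have contract₂ : cylAt A 0 ≫ cylContract A = cylAt A 0 ≫ cst _ := by
    refine TopCat.ext fun p => ContinuousMap.ext fun t => Prod.ext rfl ?_
    exact zero_mul (σ t)
  -- `A` sits at the free end `1` of the cylinder, and `D` contracts the cylinder to the end `0`
  -- that is glued to `C`.
  refine ⟨M, cylAt A 1 ≫ a, r, s, sq.desc (cylContract A ≫ pmap a) (s ≫ cst M) ?_, ?_, ?_, sr,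
    sq.hom_ext ?_ ?_, sq.hom_ext ?_ ?_, sq.hom_ext ?_ ?_⟩
  · rw [reassoc_of% contract₂, cst_pmap, ← reassoc_of% sq.w]
  · intro Z f h e
    have hw : (cylPth A ≫ pmap (a ≫ f)) ≫ ev Z 1 = h ≫ ev Z 0 := by
      rw [e]
      rfl
    -- `w x` follows `f` along the line of `x` in the cylinder and then `h x`. At time `t` the point
    -- `(x, v)` goes to `w x` at `v * (1 + t) / 2`. At `t = 0` only the first half is used, which is
    -- `f`; at `v = 1` the second half is traversed, which is `h`; at `v = 0` nothing moves, which
    -- allows gluing with the constant homotopy on `C`.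
    let w := cat (cylPth A ≫ pmap (a ≫ f)) h hw
    have e₀ : cylSlide w ≫ ev Z 0 = a ≫ f := by
      ext p
      change (w p.1 : C(I, Z)) (Set.projIcc 0 1 zero_le_one ((p.2 : ℝ) * (1 + ((0 : I) : ℝ)) / 2))
        = f (a (p.1, p.2))
      have h0 := p.2.2.1
      have h1 := p.2.2.2
      have hp : Set.projIcc 0 1 zero_le_one ((p.2 : ℝ) * (1 + ((0 : I) : ℝ)) / 2) =
          ⟨(p.2 : ℝ) / 2, by constructor <;> linarith⟩ := by
        rw [Set.projIcc_of_mem _ (x := (p.2 : ℝ) * (1 + ((0 : I) : ℝ)) / 2)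
          (by rw [Set.Icc.coe_zero, add_zero, mul_one]; constructor <;> linarith)]
        simp
      rw [hp]
      refine (if_pos (by simp only []; linarith)).trans ?_
      refine congrArg f (congrArg a (Prod.ext rfl ?_))
      apply Subtype.ext
      simp only [firstHalf, ContinuousMap.coe_mk]
      rw [Set.projIcc_of_mem _ (by constructor <;> linarith)]
      change 2 * ((p.2 : ℝ) / 2) = p.2
      ring
    have e₁ : cylAt A 1 ≫ cylSlide w = h := by
      ext p t
      change (w p : C(I, Z)) (Set.projIcc 0 1 zero_le_one (((1 : I) : ℝ) * (1 + (t : ℝ)) / 2)) = _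
      have h0 := t.2.1
      have h1 := t.2.2
      have hp : Set.projIcc 0 1 zero_le_one (((1 : I) : ℝ) * (1 + (t : ℝ)) / 2) =
          ⟨(1 + (t : ℝ)) / 2, by constructor <;> linarith⟩ := by
        rw [Set.projIcc_of_mem _ (x := ((1 : I) : ℝ) * (1 + (t : ℝ)) / 2)
          (by rw [Set.Icc.coe_one, one_mul]; constructor <;> linarith)]
        simp
      rw [hp]
      by_cases ht : (t : ℝ) = 0
      · obtain rfl : t = 0 := Subtype.ext ht
        refine (if_pos (by simp)).trans ?_
        rw [firstHalf_half (by simp)]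
        exact (ConcreteCategory.congr_hom e p).symm
      · refine (if_neg ?_).trans ?_
        · have : (0 : ℝ) < t := lt_of_le_of_ne h0 (Ne.symm ht)
          simp only [not_le]
          linarith
        · congr 1
          apply Subtype.ext
          simp only [secondHalf, ContinuousMap.coe_mk]
          rw [Set.projIcc_of_mem _ (by constructor <;> linarith)]
          ring
    have e₂ : cylAt A 0 ≫ cylSlide w = k ≫ s ≫ f ≫ cst Z := by
      ext p t
      change (w p : C(I, Z)) (Set.projIcc 0 1 zero_le_one (((0 : I) : ℝ) * (1 + (t : ℝ)) / 2)) =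
        f (s (k p))
      have : Set.projIcc 0 1 zero_le_one (((0 : I) : ℝ) * (1 + (t : ℝ)) / 2) = 0 := by
        simp
      rw [this]
      refine (ConcreteCategory.congr_hom (cat_ev_zero _ _ hw) p).trans ?_
      exact congrArg f (ConcreteCategory.congr_hom sq.w p)
    refine ⟨sq.desc (cylSlide w) (s ≫ f ≫ cst Z) e₂, sq.hom_ext ?_ ?_, ?_⟩
    · rw [sq.inl_desc_assoc, e₀]
    · rw [sq.inr_desc_assoc, Category.assoc, Category.assoc, cst_ev, Category.comp_id]
    · rw [Category.assoc, sq.inl_desc, e₁]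
  · rw [Category.assoc, ar]
    rfl
  · rw [sq.inl_desc_assoc, Category.assoc, pmap_ev, reassoc_of% contract₀, Category.comp_id]
  · rw [sq.inr_desc_assoc, Category.assoc, cst_ev, Category.comp_id]
  · rw [sq.inl_desc_assoc, Category.assoc, pmap_ev, reassoc_of% contract₁, reassoc_of% ar, sq.w]
  · rw [sq.inr_desc_assoc, Category.assoc, cst_ev, reassoc_of% sr, Category.comp_id]
  · rw [sq.inl_desc_assoc, Category.assoc, ← pmap_comp, ar, reassoc_of% ar]
    rfl
  · rw [sq.inr_desc_assoc, Category.assoc, cst_pmap, reassoc_of% sr]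

/-- A homotopy equivalence remains a homotopy equivalence after a pushout along a cofibration. -/
theorem HE.pushout {A X C P : TopCat.{u}} {i : A ⟶ X} {k : A ⟶ C} {a : X ⟶ P} {b : C ⟶ P}
    (hk : HE k) (hi : HEP i) (sq : IsPushout i k a b) : HE a := by
  -- The factor `j` is an equivalence by two-out-of-three, and the pushout along `j ≫ r` is formed
  -- in two stages, one for each of the preceding lemmas.
  obtain ⟨M, j, r, s, D, hj, rfl, hs, D₀, D₁, D₂⟩ := exists_mapping_cylinder k
  have hr : HE r := by
    refine ⟨s, ⟨D, D₀, D₁⟩, ?_⟩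
    rw [hs]
    exact Htp.refl _
  have sqN : IsPushout i j (pushout.inl i j) (pushout.inr i j) := IsPushout.of_hasPushout _ _
  have h₁ : HE (pushout.inl i j) := (hr.of_comp_right hk).pushout_of_hep hj sqN
  have hn := sqN.inl_desc a (r ≫ b) (by rw [sq.w, Category.assoc])
  have sq' : IsPushout (pushout.inr i j) r (sqN.desc a (r ≫ b) (by rw [sq.w, Category.assoc])) b :=
    (IsPushout.of_left (by rw [hn]; exact sq.flip) (by rw [sqN.inr_desc]) sqN.flip).flip
  have h₂ := HE.pushout_of_retraction hs D₀ D₁ D₂ (hi.pushout sqN) sq'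
  rw [← hn]
  exact h₁.comp h₂

/-! ### The gluing lemma -/

/-- The gluing lemma for homotopy equivalences of pushouts along cofibrations. -/
theorem HE.glue {A X C P A' X' C' P' : TopCat.{u}} {i : A ⟶ X} {k : A ⟶ C} {a : X ⟶ P} {b : C ⟶ P}
    {i' : A' ⟶ X'} {k' : A' ⟶ C'} {a' : X' ⟶ P'} {b' : C' ⟶ P'}
    (sq : IsPushout i k a b) (sq' : IsPushout i' k' a' b') (hi : HEP i) (hi' : HEP i')
    {fA : A ⟶ A'} {fX : X ⟶ X'} {fC : C ⟶ C'} {fP : P ⟶ P'} (hA : HE fA) (hX : HE fX) (hC : HE fC)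
    (ei : i ≫ fX = fA ≫ i') (ek : k ≫ fC = fA ≫ k') (ea : a ≫ fP = fX ≫ a')
    (eb : b ≫ fP = fC ≫ b') : HE fP := by
  -- `fP` factors through the pushout of `P` and `C'` over `C`. The first factor is a pushout of
  -- `fC` along a cofibration, so only the comparison `θ` to `P'` remains.
  have sq₁ : IsPushout b fC (pushout.inl b fC) (pushout.inr b fC) := IsPushout.of_hasPushout _ _
  set p₁ := pushout.inl b fC
  set c₁ := pushout.inr b fC
  have hp₁ : HE p₁ := hC.pushout (hi.pushout sq) sq₁
  have sqQ : IsPushout i fA (pushout.inl i fA) (pushout.inr i fA) := IsPushout.of_hasPushout _ _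
  set x := pushout.inl i fA
  set y := pushout.inr i fA
  have hx : HE x := hA.pushout hi sqQ
  have hy : HEP y := hi.pushout sqQ
  let θ := sq₁.desc fP b' eb
  have pθ : p₁ ≫ θ = fP := sq₁.inl_desc _ _ _
  have cθ : c₁ ≫ θ = b' := sq₁.inr_desc _ _ _
  let q := sqQ.desc fX i' ei
  have xq : x ≫ q = fX := sqQ.inl_desc _ _ _
  have yq : y ≫ q = i' := sqQ.inr_desc _ _ _
  -- `q` compares the pushout of `X` and `A'` over `A` with `X'`. It is an equivalence of
  -- cofibrations under `A'`, hence invertible relative to `A'`. The resulting homotopies are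
  -- constant on `A'` and glue with constant homotopies on `C'`.
  obtain ⟨p, hp, ⟨L, L₀, L₁, L₂⟩, ⟨K, K₀, K₁, K₂⟩⟩ := hy.exists_inverse_of_he hi' yq
    (hx.of_comp_left (by rw [xq]; exact hX))
  let w := sqQ.desc (a ≫ p₁) (k' ≫ c₁) (by rw [reassoc_of% sq.w, sq₁.w, reassoc_of% ek])
  have xw : x ≫ w = a ≫ p₁ := sqQ.inl_desc _ _ _
  have yw : y ≫ w = k' ≫ c₁ := sqQ.inr_desc _ _ _
  have wθ : w ≫ θ = q ≫ a' := by
    refine sqQ.hom_ext ?_ ?_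
    · rw [reassoc_of% xw, pθ, ea, reassoc_of% xq]
    · rw [reassoc_of% yw, cθ, reassoc_of% yq, sq'.w]
  let ξ := sq'.desc (p ≫ w) c₁ (by rw [reassoc_of% hp, yw])
  have aξ : a' ≫ ξ = p ≫ w := sq'.inl_desc _ _ _
  have bξ : b' ≫ ξ = c₁ := sq'.inr_desc _ _ _
  have hθ : HE θ := by
    refine ⟨ξ, Htp.symm ?_, Htp.symm ?_⟩
    · have e₁ : i ≫ x ≫ L ≫ pmap w = k ≫ fC ≫ c₁ ≫ cst _ := by
        rw [reassoc_of% sqQ.w, reassoc_of% L₂, reassoc_of% yq, reassoc_of% hp, cst_pmap,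
          reassoc_of% yw, reassoc_of% ek]
      have e₂ : b ≫ sq.desc (x ≫ L ≫ pmap w) (fC ≫ c₁ ≫ cst _) e₁ = fC ≫ c₁ ≫ cst _ :=
        sq.inr_desc _ _ _
      refine ⟨sq₁.desc (sq.desc (x ≫ L ≫ pmap w) (fC ≫ c₁ ≫ cst _) e₁) (c₁ ≫ cst _) e₂,
        sq₁.hom_ext (sq.hom_ext ?_ ?_) ?_, sq₁.hom_ext (sq.hom_ext ?_ ?_) ?_⟩
      · rw [sq₁.inl_desc_assoc, sq.inl_desc_assoc, Category.assoc, Category.assoc, pmap_ev,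
          reassoc_of% L₀, reassoc_of% pθ, reassoc_of% ea, aξ, reassoc_of% xq]
      · rw [sq₁.inl_desc_assoc, sq.inr_desc_assoc, Category.assoc, Category.assoc, cst_ev,
          Category.comp_id, reassoc_of% sq₁.w, reassoc_of% cθ, bξ]
      · rw [sq₁.inr_desc_assoc, Category.assoc, cst_ev, Category.comp_id, reassoc_of% cθ, bξ]
      · rw [sq₁.inl_desc_assoc, sq.inl_desc_assoc, Category.assoc, Category.assoc, pmap_ev,
          reassoc_of% L₁, xw, Category.comp_id]
      · rw [sq₁.inl_desc_assoc, sq.inr_desc_assoc, Category.assoc, Category.assoc, cst_ev,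
          Category.comp_id, Category.comp_id, sq₁.w]
      · rw [sq₁.inr_desc_assoc, Category.assoc, cst_ev]
    · refine ⟨sq'.desc (K ≫ pmap a') (b' ≫ cst _) ?_, sq'.hom_ext ?_ ?_, sq'.hom_ext ?_ ?_⟩
      · rw [reassoc_of% K₂, reassoc_of% hp, reassoc_of% yq, cst_pmap, reassoc_of% sq'.w]
      · rw [sq'.inl_desc_assoc, Category.assoc, pmap_ev, reassoc_of% K₀, reassoc_of% aξ, wθ]
      · rw [sq'.inr_desc_assoc, Category.assoc, cst_ev, reassoc_of% bξ, cθ, Category.comp_id]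
      · rw [sq'.inl_desc_assoc, Category.assoc, pmap_ev, reassoc_of% K₁, Category.comp_id]
      · rw [sq'.inr_desc_assoc, Category.assoc, cst_ev]
  rw [← pθ]
  exact hp₁.comp hθ

/-! ### Homotopy equivalences of pairs -/

/-- Homotopy of maps of pairs. -/
def PairHtp {A X B Y : TopCat.{u}} (i : A ⟶ X) (j : B ⟶ Y) (fA gA : A ⟶ B) (f g : X ⟶ Y) : Prop :=
  ∃ (k : A ⟶ Pth B) (h : X ⟶ Pth Y), k ≫ ev B 0 = fA ∧ k ≫ ev B 1 = gA ∧ h ≫ ev Y 0 = f ∧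
    h ≫ ev Y 1 = g ∧ i ≫ h = k ≫ pmap j

section Pair

variable {A X B Y : TopCat.{u}} {i : A ⟶ X} {j : B ⟶ Y}

theorem PairHtp.symm {fA gA : A ⟶ B} {f g : X ⟶ Y} (h : PairHtp i j fA gA f g) :
    PairHtp i j gA fA g f := by
  obtain ⟨k, h, rfl, rfl, rfl, rfl, e⟩ := h
  refine ⟨k ≫ rev B, h ≫ rev Y, ?_, ?_, ?_, ?_, ?_⟩
  · rw [Category.assoc, rev_ev_zero]
  · rw [Category.assoc, rev_ev_one]
  · rw [Category.assoc, rev_ev_zero]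
  · rw [Category.assoc, rev_ev_one]
  · rw [reassoc_of% e, Category.assoc, rev_pmap]

theorem PairHtp.trans {fA gA hA : A ⟶ B} {f g h : X ⟶ Y} (p : PairHtp i j fA gA f g)
    (q : PairHtp i j gA hA g h) : PairHtp i j fA hA f h := by
  obtain ⟨k, h, k₀, k₁, h₀, h₁, e⟩ := p
  obtain ⟨k', h', k₀', k₁', h₀', h₁', e'⟩ := q
  refine ⟨cat k k' (k₁.trans k₀'.symm), cat h h' (h₁.trans h₀'.symm), ?_, ?_, ?_, ?_, ?_⟩
  · rw [cat_ev_zero, k₀]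
  · rw [cat_ev_one, k₁']
  · rw [cat_ev_zero, h₀]
  · rw [cat_ev_one, h₁']
  · rw [comp_cat, cat_pmap]
    exact cat_congr _ e e'

theorem PairHtp.comp_right {fA gA : A ⟶ B} {f g : X ⟶ Y} (p : PairHtp i j fA gA f g)
    {E Z : TopCat.{u}} {l : E ⟶ Z} (hA : B ⟶ E) (h : Y ⟶ Z) (e : j ≫ h = hA ≫ l) :
    PairHtp i l (fA ≫ hA) (gA ≫ hA) (f ≫ h) (g ≫ h) := by
  obtain ⟨k, p, rfl, rfl, rfl, rfl, e'⟩ := p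
  refine ⟨k ≫ pmap hA, p ≫ pmap h, rfl, rfl, rfl, rfl, ?_⟩
  rw [reassoc_of% e', ← pmap_comp, e]
  rfl

theorem PairHtp.comp_left {fA gA : A ⟶ B} {f g : X ⟶ Y} (p : PairHtp i j fA gA f g)
    {E Z : TopCat.{u}} {l : E ⟶ Z} (hA : E ⟶ A) (h : Z ⟶ X) (e : l ≫ h = hA ≫ i) :
    PairHtp l j (hA ≫ fA) (hA ≫ gA) (h ≫ f) (h ≫ g) := by
  obtain ⟨k, p, rfl, rfl, rfl, rfl, e'⟩ := p
  refine ⟨hA ≫ k, h ≫ p, rfl, rfl, rfl, rfl, ?_⟩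
  rw [reassoc_of% e, e', Category.assoc]

/-- `f` factors as `x ≫ q` through the pushout of `X` and `B` over `A`. The second factor has an
inverse `p` relative to `B`. Extending the homotopy from `𝟙 A` to `fA ≫ gA` over `X` gives a map
that glues with `gA ≫ i` to a map `r` back to `X`; the inverse is `p ≫ r`. -/
theorem HEP.exists_left_inverse_extending (hi : HEP i) (hj : HEP j) {f : X ⟶ Y} {fA : A ⟶ B}
    (e : i ≫ f = fA ≫ j) (hf : HE f) (hA : HE fA) {gA : B ⟶ A} (hgA : Htp (𝟙 A) (fA ≫ gA)) :
    ∃ g : Y ⟶ X, j ≫ g = gA ≫ i ∧ PairHtp i i (𝟙 A) (fA ≫ gA) (𝟙 X) (f ≫ g) := by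
  obtain ⟨k, k₀, k₁⟩ := hgA
  obtain ⟨H, H₀, H₁⟩ := hi X (𝟙 X) (k ≫ pmap i) (by
    rw [Category.assoc, pmap_ev, reassoc_of% k₀, Category.comp_id])
  have sqQ : IsPushout i fA (pushout.inl i fA) (pushout.inr i fA) := IsPushout.of_hasPushout _ _
  set x := pushout.inl i fA
  set y := pushout.inr i fA
  let q := sqQ.desc f j e
  have xq : x ≫ q = f := sqQ.inl_desc _ _ _
  have yq : y ≫ q = j := sqQ.inr_desc _ _ _
  obtain ⟨p, hp, L, -⟩ := (hi.pushout sqQ).exists_inverse_of_he hj yq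
    ((hA.pushout hi sqQ).of_comp_left (by rw [xq]; exact hf))
  obtain ⟨L, L₀, L₁, L₂⟩ := L.symm
  let r := sqQ.desc (H ≫ ev X 1) (gA ≫ i) (by
    rw [reassoc_of% H₁, pmap_ev, reassoc_of% k₁])
  have xr : x ≫ r = H ≫ ev X 1 := sqQ.inl_desc _ _ _
  have yr : y ≫ r = gA ≫ i := sqQ.inr_desc _ _ _
  refine ⟨p ≫ r, by rw [reassoc_of% hp, yr], ?_⟩
  have a : PairHtp i i (𝟙 A) (fA ≫ gA) (𝟙 X) (x ≫ r) := ⟨k, H, k₀, k₁, H₀, xr.symm, H₁⟩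
  refine a.trans ⟨(fA ≫ gA) ≫ cst A, x ≫ L ≫ pmap r, rfl, rfl, ?_, ?_, ?_⟩
  · rw [Category.assoc, Category.assoc, pmap_ev, reassoc_of% L₀]
  · rw [Category.assoc, Category.assoc, pmap_ev, reassoc_of% L₁, reassoc_of% xq]
  · rw [reassoc_of% sqQ.w, reassoc_of% L₂, cst_pmap, reassoc_of% yr, Category.assoc,
      Category.assoc, cst_pmap]

/-- A map of cofibrations that consists of homotopy equivalences is a homotopy equivalence
of pairs, and every homotopy inverse on the subspaces extends to one of pairs. -/
theorem HEP.exists_inverse_extending (hi : HEP i) (hj : HEP j) {f : X ⟶ Y} {fA : A ⟶ B}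
    (e : i ≫ f = fA ≫ j) (hf : HE f) {gA : B ⟶ A} (hgA : Htp (𝟙 A) (fA ≫ gA))
    (hgA' : Htp (𝟙 B) (gA ≫ fA)) :
    ∃ g : Y ⟶ X, j ≫ g = gA ≫ i ∧ PairHtp i i (𝟙 A) (fA ≫ gA) (𝟙 X) (f ≫ g) ∧
      PairHtp j j (𝟙 B) (gA ≫ fA) (𝟙 Y) (g ≫ f) := by
  obtain ⟨g, hg, p⟩ := hi.exists_left_inverse_extending hj e hf ⟨gA, hgA, hgA'⟩ hgA
  have hg' : HE g := hf.of_comp_left ((HE.of_isIso (𝟙 X)).of_htp (by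
    obtain ⟨_, h, _, _, h₀, h₁, _⟩ := p
    exact ⟨h, h₀, h₁⟩))
  -- The left inverse of `g` is taken to extend `fA`, so the comparison of `g ≫ f` with `g ≫ f'`
  -- through `g ≫ f ≫ g ≫ f'` is made by homotopies of pairs.
  obtain ⟨f', hf', p'⟩ := hj.exists_left_inverse_extending hi hg hg' ⟨fA, hgA', hgA⟩ hgA'
  refine ⟨g, hg, p, ?_⟩
  have e₁ : j ≫ g ≫ f = (gA ≫ fA) ≫ j := by rw [reassoc_of% hg, e, Category.assoc]
  have s₁ := p'.comp_left (gA ≫ fA) (g ≫ f) e₁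
  have s₂ := (p.symm.comp_right fA f' hf').comp_left gA g hg
  simp only [Category.assoc, Category.id_comp, Category.comp_id] at s₁ s₂
  exact p'.trans (s₂.symm.trans s₁.symm)

end Pair


open unitInterval

/-! ### Strøm structures -/

/-- A function `u` and a deformation `h` of `X` that exhibit the inclusion of the closed subset `A`
as a cofibration. -/
structure StromData {X : Type*} [TopologicalSpace X] (A : Set X) where
  isClosed : IsClosed A
  u : C(X, I)
  h : C(X × I, X)
  h_zero : ∀ x, h (x, 0) = x
  h_of_mem : ∀ x ∈ A, ∀ t, h (x, t) = x
  u_of_mem : ∀ x ∈ A, u x = 0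
  h_mem : ∀ x t, u x < t → h (x, t) ∈ A

namespace StromData

variable {X : Type*} [TopologicalSpace X] {A : Set X} (S : StromData A)
include S

/-- When `u x = t`, the point is a limit of points of the closed set `A` at later times, which exist
because `u x < 1`. -/
theorem h_mem_of_le {x : X} {t : I} (h : S.u x ≤ t) (h' : S.u x < 1) : S.h (x, t) ∈ A := by
  rcases h.lt_or_eq with h | rfl
  · exact S.h_mem x t h
  · have hc : S.u x ∈ closure (Set.Ioi (S.u x)) := by
      have hne : (Set.Ioi (S.u x)).Nonempty := ⟨1, h'⟩
      rw [closure_Ioi' hne]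
      exact Set.self_mem_Ici
    have hm : Set.MapsTo (fun t => S.h (x, t)) (Set.Ioi (S.u x)) A := fun t ht => S.h_mem x t ht
    have := hm.closure (by fun_prop) hc
    rwa [S.isClosed.closure_eq] at this

end StromData

/-- The inclusion of a closed subset with a Strøm structure has the homotopy extension property. -/
theorem StromData.hep {B X : TopCat.{u}} {b : B ⟶ X} (hb : Topology.IsClosedEmbedding b)
    (S : StromData (Set.range b)) : HEP b := by
  intro Z f h e
  -- Up to time `2 * u` the extension is `f` along the deformation; afterwards the deformed point
  -- lies in `A` and the given homotopy runs for the time `t - 2 * u`. The factor `2` gives `u ≤ 1/2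
  -- < 1` on `C`, as `h_mem_of_le` requires.
  let C : Set (X × I) := {p | 2 * (S.u p.1 : ℝ) ≤ p.2}
  have hC : IsClosed C := isClosed_le (by fun_prop) (by fun_prop)
  have hmem (p : X × I) (hp : p ∈ C) : S.h p ∈ Set.range b := by
    have h0 := (S.u p.1).2.1
    have h1 := p.2.2.2
    have hp' : 2 * (S.u p.1 : ℝ) ≤ p.2 := hp
    refine S.h_mem_of_le (x := p.1) (t := p.2) (Subtype.coe_le_coe.1 ?_) (Subtype.coe_lt_coe.1 ?_)
    · linarith
    · rw [Set.Icc.coe_one]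
      linarith
  let lift : C → B := fun p => hb.isEmbedding.toHomeomorph.symm ⟨S.h p.1, hmem p.1 p.2⟩
  have hlift : Continuous lift :=
    hb.isEmbedding.toHomeomorph.symm.continuous.comp (by fun_prop)
  have b_lift (p : C) : b (lift p) = S.h p.1 :=
    congrArg Subtype.val (hb.isEmbedding.toHomeomorph.apply_symm_apply ⟨S.h p.1, hmem p.1 p.2⟩)
  let G : C → Z := fun p => (h (lift p) : C(I, Z))
    (Set.projIcc 0 1 zero_le_one ((p.1.2 : ℝ) - 2 * S.u p.1.1))
  have hG : Continuous G := (continuous_uncurryPth h).comp (hlift.prodMk (by fun_prop))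
  classical
  let F : X × I → Z := fun p => if hp : p ∈ C then G ⟨p, hp⟩ else f (S.h p)
  have FC (p : C) : F p.1 = G p := dif_pos p.2
  have FD (p : X × I) (hp : (p.2 : ℝ) ≤ 2 * S.u p.1) : F p = f (S.h p) := by
    by_cases hp' : p ∈ C
    · have e₁ : (p.2 : ℝ) - 2 * S.u p.1 = 0 := sub_eq_zero.2 (le_antisymm hp hp')
      have e₂ : G ⟨p, hp'⟩ = (h (lift ⟨p, hp'⟩) : C(I, Z)) 0 := by
        change (h (lift ⟨p, hp'⟩) : C(I, Z)) (Set.projIcc 0 1 zero_le_one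
          ((p.2 : ℝ) - 2 * S.u p.1)) = _
        rw [e₁, Set.projIcc_left]
        rfl
      rw [FC ⟨p, hp'⟩, e₂]
      refine (ConcreteCategory.congr_hom e (lift ⟨p, hp'⟩)).trans ?_
      exact congrArg f (b_lift ⟨p, hp'⟩)
    · exact dif_neg hp'
  have hF : Continuous F := by
    have h₁ : ContinuousOn F C := by
      rw [continuousOn_iff_continuous_domRestrict]
      exact hG.congr fun p => (FC p).symm
    have h₂ : ContinuousOn F {p | (p.2 : ℝ) ≤ 2 * S.u p.1} :=
      ContinuousOn.congr (f := fun p => f (S.h p))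
        (f.hom.continuous.comp S.h.continuous).continuousOn FD
    have := h₁.union_of_isClosed h₂ hC (isClosed_le (by fun_prop) (by fun_prop))
    rw [← continuousOn_univ]
    refine this.mono fun p _ => ?_
    exact le_total (2 * (S.u p.1 : ℝ)) (p.2 : ℝ)
  refine ⟨curryPth F hF, ?_, ?_⟩
  · ext x
    refine (FD (x, 0) ?_).trans (congrArg f (S.h_zero x))
    have := (S.u x).2.1
    simp only [Set.Icc.coe_zero]
    linarith
  · ext y t
    have hu := S.u_of_mem (b y) ⟨y, rfl⟩
    have hp : (b y, t) ∈ C := by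
      change 2 * (S.u (b y) : ℝ) ≤ t
      rw [hu, Set.Icc.coe_zero, mul_zero]
      exact t.2.1
    have e₁ : lift ⟨(b y, t), hp⟩ = y := hb.injective
      ((b_lift ⟨(b y, t), hp⟩).trans (S.h_of_mem _ ⟨y, rfl⟩ t))
    refine (FC ⟨(b y, t), hp⟩).trans ?_
    change (h (lift ⟨(b y, t), hp⟩) : C(I, Z)) (Set.projIcc 0 1 zero_le_one
      ((t : ℝ) - 2 * S.u (b y))) = _
    rw [e₁, hu, Set.Icc.coe_zero, mul_zero, sub_zero, Set.projIcc_val]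

/-- The inclusion of a closed subset that has the homotopy extension property has a Strøm
structure. -/
theorem HEP.nonempty_stromData {X : TopCat.{u}} {A : Set X} (hA : IsClosed A)
    (h : HEP (TopCat.ofHom (⟨Subtype.val, continuous_subtype_val⟩ : C(A, X)))) :
    Nonempty (StromData A) := by
  let T : TopCat.{u} := TopCat.of {p : X × I // p.2 = 0 ∨ p.1 ∈ A}
  let f : X ⟶ T := TopCat.ofHom ⟨fun x => ⟨(x, 0), Or.inl rfl⟩, by fun_prop⟩
  let k : TopCat.of A ⟶ Pth T := curryPth (fun p => ⟨(p.1.1, p.2), Or.inr p.1.2⟩) (by fun_prop)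
  -- Extending the tautological homotopy yields a retraction `r` of `X × I` onto `X × 0 ∪ A × I`.
  -- Its first coordinate is the deformation, and `u x` is the sup norm of the amount by which `r`
  -- changes the time. Where `r (x, t)` is not over `A` its time is `0`, so `t ≤ u x`.
  obtain ⟨H, H₀, H₁⟩ := h T f k rfl
  let r : X × I → {p : X × I // p.2 = 0 ∨ p.1 ∈ A} := fun p => (H p.1 : C(I, T)) p.2
  have hr : Continuous r := continuous_uncurryPth H
  let g : C(X, C(I, ℝ)) := ContinuousMap.curry ⟨fun p => (p.2 : ℝ) - ((r p).1.2 : ℝ), by fun_prop⟩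
  have r₀ (x : X) : r (x, 0) = ⟨(x, 0), Or.inl rfl⟩ := ConcreteCategory.congr_hom H₀ x
  have rA (x : X) (hx : x ∈ A) (t : I) : r (x, t) = ⟨(x, t), Or.inr hx⟩ :=
    congrArg (fun w : C(I, T) => w t) (ConcreteCategory.congr_hom H₁ ⟨x, hx⟩)
  refine ⟨⟨hA, ⟨fun x => Set.projIcc 0 1 zero_le_one ‖g x‖, by fun_prop⟩,
    ⟨fun p => (r p).1.1, by fun_prop⟩, fun x => ?_, fun x hx t => ?_, fun x hx => ?_, fun x t ht => ?_⟩⟩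
  · exact congrArg (fun q : T => q.1.1) (r₀ x)
  · exact congrArg (fun q : T => q.1.1) (rA x hx t)
  · have : g x = 0 := by
      ext t
      change (t : ℝ) - ((r (x, t)).1.2 : ℝ) = 0
      rw [rA x hx t, sub_self]
    change Set.projIcc 0 1 zero_le_one ‖g x‖ = 0
    rw [this, norm_zero, Set.projIcc_left]
    rfl
  · have hlt : ‖g x‖ < t := by
      have ht' : (Set.projIcc (0 : ℝ) 1 zero_le_one ‖g x‖ : ℝ) < t := ht
      rw [Set.coe_projIcc] at ht'
      have h1 := t.2.2
      have := lt_of_le_of_lt (le_max_right _ _) ht'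
      rcases min_lt_iff.1 this with h | h
      · linarith
      · exact h
    have hle : (t : ℝ) - ((r (x, t)).1.2 : ℝ) ≤ ‖g x‖ :=
      (le_abs_self _).trans ((g x).norm_coe_le_norm t)
    rcases (r (x, t)).2 with h | h
    · rw [h, Set.Icc.coe_zero] at hle
      linarith
    · exact h

/-! ### Disks and relative cell complexes -/

theorem isClosedEmbedding_diskBoundaryInclusion (n : ℕ) :
    Topology.IsClosedEmbedding (TopCat.diskBoundaryInclusion.{u} n) := by
  have : T2Space (TopCat.disk.{u} n) :=
    inferInstanceAs (T2Space (ULift (Metric.closedBall (0 : EuclideanSpace ℝ (Fin n)) 1)))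
  exact (TopCat.diskBoundaryInclusion n).hom.continuous.isClosedEmbedding
    ((TopCat.mono_iff_injective _).1 inferInstance)

/-- The norm on the disk. -/
noncomputable def diskNorm (n : ℕ) : C(TopCat.disk.{u} n, ℝ) :=
  ⟨fun x => ‖(ULift.down (α := Metric.closedBall (0 : EuclideanSpace ℝ (Fin n)) 1) x).1‖, by
    exact (continuous_subtype_val.comp continuous_uliftDown).norm⟩

theorem diskNorm_le (n : ℕ) (x : TopCat.disk.{u} n) : diskNorm n x ≤ 1 :=
  mem_closedBall_zero_iff.1
    (ULift.down (α := Metric.closedBall (0 : EuclideanSpace ℝ (Fin n)) 1) x).2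

theorem mem_range_diskBoundaryInclusion (n : ℕ) (x : TopCat.disk.{u} n) :
    x ∈ Set.range (TopCat.diskBoundaryInclusion n) ↔ diskNorm n x = 1 := by
  constructor
  · rintro ⟨y, rfl⟩
    exact mem_sphere_zero_iff_norm.1
      (ULift.down (α := Metric.sphere (0 : EuclideanSpace ℝ (Fin n)) 1) y).2
  · intro h
    exact ⟨ULift.up ⟨(ULift.down (α := Metric.closedBall (0 : EuclideanSpace ℝ (Fin n)) 1) x).1,
      mem_sphere_zero_iff_norm.2 h⟩, rfl⟩

/-- The radial deformation of a unit ball towards its boundary. -/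
noncomputable def ballPush {E : Type*} [NormedAddCommGroup E] [NormedSpace ℝ E] :
    C(Metric.closedBall (0 : E) 1 × I, Metric.closedBall (0 : E) 1) where
  toFun p := ⟨((1 + (p.2 : ℝ)) / max 1 ((1 + (p.2 : ℝ)) * ‖p.1.1‖)) • p.1.1, by
    have h0 := p.2.2.1
    have hpos : 0 < max 1 ((1 + (p.2 : ℝ)) * ‖p.1.1‖) := lt_max_of_lt_left one_pos
    rw [mem_closedBall_zero_iff, norm_smul, Real.norm_of_nonneg (by positivity), div_mul_eq_mul_div,
      div_le_one hpos]
    exact le_max_right _ _⟩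
  continuous_toFun := by
    refine Continuous.subtype_mk (Continuous.smul (Continuous.div (by fun_prop) (by fun_prop)
      fun p => ?_) (by fun_prop)) _
    exact (lt_max_of_lt_left one_pos).ne'

/-- The Strøm structure of the boundary sphere of a disk. -/
noncomputable def diskStromData (n : ℕ) :
    StromData (Set.range (TopCat.diskBoundaryInclusion.{u} n)) where
  isClosed := (isClosedEmbedding_diskBoundaryInclusion n).isClosed_range
  u := ⟨fun x => Set.projIcc 0 1 zero_le_one (2 * (1 - diskNorm n x)), by fun_prop⟩
  h := ⟨fun p => ULift.up (ballPush
      (ULift.down (α := Metric.closedBall (0 : EuclideanSpace ℝ (Fin n)) 1) p.1, p.2)), by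
    exact continuous_uliftUp.comp (ballPush.continuous.comp
      ((continuous_uliftDown.comp continuous_fst).prodMk continuous_snd))⟩
  h_zero x := by
    have hx := diskNorm_le n x
    refine ULift.ext _ _ (Subtype.ext ?_)
    change ((1 + ((0 : I) : ℝ)) / max 1 ((1 + ((0 : I) : ℝ)) * diskNorm n x)) • _ = _
    rw [Set.Icc.coe_zero, add_zero, one_mul, max_eq_left hx, div_one, one_smul]
  h_of_mem x hx t := by
    rw [mem_range_diskBoundaryInclusion] at hx
    have h0 := t.2.1
    refine ULift.ext _ _ (Subtype.ext ?_)
    change ((1 + (t : ℝ)) / max 1 ((1 + (t : ℝ)) * diskNorm n x)) • _ = _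
    rw [hx, mul_one, max_eq_right (by linarith), div_self (by linarith), one_smul]
  u_of_mem x hx := by
    rw [mem_range_diskBoundaryInclusion] at hx
    change Set.projIcc 0 1 zero_le_one (2 * (1 - diskNorm n x)) = 0
    rw [hx, sub_self, mul_zero, Set.projIcc_left]
    rfl
  h_mem x t ht := by
    rw [mem_range_diskBoundaryInclusion]
    have h0 := t.2.1
    have h1 := t.2.2
    have hx := diskNorm_le n x
    have ht' : (Set.projIcc (0 : ℝ) 1 zero_le_one (2 * (1 - diskNorm n x)) : ℝ) < t := ht
    rw [Set.coe_projIcc] at ht'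
    have hr : 2 * (1 - diskNorm n x) < t := by
      rcases min_lt_iff.1 (lt_of_le_of_lt (le_max_right _ _) ht') with h | h
      · linarith
      · exact h
    -- The norm exceeds `1 - t / 2`, and `(1 + t) * (1 - t / 2) = 1 + t * (1 - t) / 2` is at least
    -- `1`; this accounts for the factor `2` in `u`.
    have hge : 1 ≤ (1 + (t : ℝ)) * diskNorm n x := by nlinarith
    change ‖((1 + (t : ℝ)) / max 1 ((1 + (t : ℝ)) * diskNorm n x)) •
      (ULift.down (α := Metric.closedBall (0 : EuclideanSpace ℝ (Fin n)) 1) x).1‖ = 1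
    rw [norm_smul, max_eq_right hge, Real.norm_of_nonneg (div_nonneg (by linarith) (by linarith)),
      div_mul_eq_mul_div]
    exact div_self (lt_of_lt_of_le one_pos hge).ne'

/-! ### Relative cell complexes through lifting properties. -/

/-- The boundary inclusions of the disks. -/
abbrev diskInclusions : MorphismProperty TopCat.{u} :=
  MorphismProperty.ofHoms fun n : ℕ => TopCat.diskBoundaryInclusion.{u} n

/-- Lifting against `ev Z 0` is homotopy extension with target `Z`. Homotopy extension is thus a
left lifting property and passes from spheres in disks to all relative cell complexes at once. -/
theorem rlp_ev (Z : TopCat.{u}) : diskInclusions.rlp (ev Z 0) := by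
  rintro _ _ _ ⟨n⟩
  refine ⟨fun {f g} sq => ?_⟩
  obtain ⟨H, H₀, H₁⟩ := (diskStromData n).hep (isClosedEmbedding_diskBoundaryInclusion n) Z g f sq.w
  exact ⟨⟨⟨H, H₁, H₀⟩⟩⟩

theorem hep_of_llp_rlp {A X : TopCat.{u}} {i : A ⟶ X} (h : diskInclusions.rlp.llp i) : HEP i := by
  intro Z f k e
  have := h _ (rlp_ev Z)
  have sq : CommSq k i (ev Z 0) f := ⟨e⟩
  exact ⟨sq.lift, sq.fac_right, sq.fac_left⟩

/-- The space over `Z` of pairs of a point `z` and a number `t` in the unit interval that is nonzero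
unless `z` lies in `A`. -/
abbrev Marked {Z : TopCat.{u}} (A : Set Z) : TopCat.{u} := TopCat.of {p : Z × I // p.1 ∉ A → p.2 ≠ 0}

/-- The projection to the base space. -/
def Marked.proj {Z : TopCat.{u}} (A : Set Z) : Marked A ⟶ Z :=
  TopCat.ofHom ⟨fun p => p.1.1, by fun_prop⟩

/-- A marking of the sphere extends to the disk by Tietze. Its maximum with `1 - ‖x‖` is unchanged
on the sphere and nonzero in the interior. -/
theorem Marked.rlp_proj {Z : TopCat.{u}} (A : Set Z) : diskInclusions.rlp (Marked.proj A) := by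
  rintro _ _ _ ⟨n⟩
  refine ⟨fun {f g} sq => ?_⟩
  have hcl := isClosedEmbedding_diskBoundaryInclusion.{u} n
  have : T2Space (TopCat.disk.{u} n) :=
    inferInstanceAs (T2Space (ULift (Metric.closedBall (0 : EuclideanSpace ℝ (Fin n)) 1)))
  let f' : TopCat.diskBoundary.{u} n → {p : Z × I // p.1 ∉ A → p.2 ≠ 0} := f
  have hf' : Continuous f' := f.hom.continuous
  let v : C(TopCat.diskBoundary.{u} n, I) := ⟨fun y => (f' y).1.2, by fun_prop⟩
  obtain ⟨V, hV⟩ := ContinuousMap.exists_extension hcl v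
  have hV' (y) : V (TopCat.diskBoundaryInclusion n y) = (f' y).1.2 :=
    congrArg (fun w : C(TopCat.diskBoundary.{u} n, I) => w y) hV
  have hw (y) : (f' y).1.1 = g (TopCat.diskBoundaryInclusion n y) :=
    ConcreteCategory.congr_hom sq.w y
  let ν : C(TopCat.disk.{u} n, I) :=
    ⟨fun x => max (V x) (Set.projIcc 0 1 zero_le_one (1 - diskNorm n x)), by fun_prop⟩
  have hν (y) : ν (TopCat.diskBoundaryInclusion n y) = (f' y).1.2 := by
    have := (mem_range_diskBoundaryInclusion n _).1 ⟨y, rfl⟩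
    change max (V _) (Set.projIcc 0 1 zero_le_one (1 - diskNorm n _)) = _
    rw [this, sub_self, Set.projIcc_left, hV']
    exact max_eq_left nonneg'
  have hmem (x : TopCat.disk.{u} n) : g x ∉ A → ν x ≠ 0 := by
    intro hx h0
    have : diskNorm n x = 1 := by
      have h₁ : Set.projIcc (0 : ℝ) 1 zero_le_one (1 - diskNorm n x) ≤ 0 :=
        (le_max_right _ _).trans h0.le
      have h₂ : (Set.projIcc (0 : ℝ) 1 zero_le_one (1 - diskNorm n x) : ℝ) ≤ 0 := h₁
      rw [Set.coe_projIcc] at h₂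
      have h₃ := diskNorm_le n x
      rcases min_le_iff.1 ((le_max_right _ _).trans h₂) with h | h
      · linarith
      · linarith
    obtain ⟨y, rfl⟩ := (mem_range_diskBoundaryInclusion n x).2 this
    rw [hν] at h0
    rw [← hw] at hx
    exact (f' y).2 hx h0
  refine ⟨⟨⟨TopCat.ofHom ⟨fun x => ⟨(g x, ν x), hmem x⟩, ?_⟩, ?_, rfl⟩⟩⟩
  · have := g.hom.continuous
    fun_prop
  · refine TopCat.ext fun y => ?_
    exact Subtype.ext (Prod.ext (hw y).symm (hν y) :
      (g (TopCat.diskBoundaryInclusion n y), ν (TopCat.diskBoundaryInclusion n y)) = (f' y).1)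

/-- Lifting `𝟙 X` to the marked space, with marking `0` on `A`, gives a continuous function on `X`
whose zero set is the image of `A`. -/
theorem isClosed_range_of_llp_rlp {A X : TopCat.{u}} {i : A ⟶ X}
    (h : diskInclusions.rlp.llp i) : IsClosed (Set.range i) := by
  let π := Marked.proj (Set.range i)
  have := h _ (Marked.rlp_proj (Set.range i))
  have sq : CommSq (TopCat.ofHom ⟨fun a => ⟨(i a, 0), fun ha => (ha ⟨a, rfl⟩).elim⟩, by
      have := i.hom.continuous
      fun_prop⟩ : A ⟶ Marked (Set.range i)) i π (𝟙 X) := ⟨rfl⟩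
  have e : Set.range i = (fun x => (sq.lift x).1.2) ⁻¹' {0} := by
    ext x
    constructor
    · rintro ⟨a, rfl⟩
      exact congrArg (fun p : Marked (Set.range i) => p.1.2) (ConcreteCategory.congr_hom sq.fac_left a)
    · intro hx
      by_contra hx'
      refine (sq.lift x).2 ?_ hx
      have : (sq.lift x).1.1 = x := ConcreteCategory.congr_hom sq.fac_right x
      rwa [this]
  rw [e]
  refine isClosed_singleton.preimage ?_
  have := sq.lift.hom.continuous
  fun_prop

end TopHtpy

-- The cell structure enters the argument only through these data. Being explicit functions, they
-- can be combined over the factors of a product and carried over to the compactly generated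
-- topology.
open TopHtpy in
theorem PowerCouple.IsCW.nonempty_stromData {X : PowerCouple.{u}} (h : X.IsCW) :
    Nonempty (StromData X.sub) := by
  obtain ⟨h⟩ := h
  have hl : diskInclusions.rlp.llp X.subInclusion :=
    MorphismProperty.transfiniteCompositionsOfShape_pushouts_coproducts_le_llp_rlp.{u} _ ℕ _
      h.transfiniteCompositionOfShape.mem
  have hc := isClosed_range_of_llp_rlp hl
  have e : Set.range X.subInclusion = X.sub := Subtype.range_coe
  rw [e] at hc
  exact HEP.nonempty_stromData (X := TopCat.of X) hc (hep_of_llp_rlp hl)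

namespace TopHtpy

open unitInterval (nonneg' le_one')

/-! ### Compactly generated topologies -/

theorem continuous_to_kified {K T : Type u} [TopologicalSpace K] [CompactSpace K] [T2Space K]
    [TopologicalSpace T] {g : K → T} (hg : Continuous g) : Continuous (Y := Kified T) g := by
  let F : (Σ i : (K : CompHaus.{u}) × C(K, T), i.fst) → Kified T := fun p => p.1.2 p.2
  have hF : Continuous F := continuous_coinduced_rng
  exact hF.comp (continuous_sigmaMk (σ := fun i : (K : CompHaus.{u}) × C(K, T) => i.fst)
    (i := ⟨CompHaus.of K, ⟨g, hg⟩⟩))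

theorem continuous_of_kified (S : Type u) [TopologicalSpace S] :
    Continuous (X := Kified S) (Y := S) id :=
  continuous_from_compactlyGenerated.{u} (X := S) (Y := S) id fun _ g => g.continuous

/-- After currying the interval, continuity is tested on maps `K → S` from compact Hausdorff spaces.
There `K × I` is again compact Hausdorff, so maps from it to `T` are continuous into `Kified T`. -/
theorem continuous_kified_prod {S T : Type u} [TopologicalSpace S] [TopologicalSpace T]
    {f : S × unitInterval → T} (hf : Continuous f) : Continuous (X := Kified S × unitInterval) (Y := Kified T) f := by
  have hK (K : Type u) [TopologicalSpace K] [CompactSpace K] [T2Space K] (g : K → S)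
      (hg : Continuous g) : Continuous (Y := Kified T) fun p : K × unitInterval => f (g p.1, p.2) :=
    continuous_to_kified (by fun_prop)
  let F : Kified S → C(unitInterval, Kified T) := fun s => ⟨fun t => f (s, t),
    (hK PUnit (fun _ => s) continuous_const).comp (by fun_prop : Continuous fun t : unitInterval =>
      (PUnit.unit, t))⟩
  have hF : Continuous F := by
    refine continuous_from_compactlyGenerated.{u} (X := S) (Y := C(unitInterval, Kified T)) F fun K g => ?_
    exact ContinuousMap.continuous_of_continuous_uncurry _ (hK K g g.continuous)
  exact ContinuousMap.continuous_uncurry_of_continuous ⟨F, hF⟩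

/-- For a test map `g : K → T`, the preimage of the range of `f` is closed in `K`, hence compact,
and lifts to a test map to `S`. -/
theorem isClosedMap_kified {S T : Type u} [TopologicalSpace S] [TopologicalSpace T]
    {f : S → T} (hf : Topology.IsClosedEmbedding f) :
    IsClosedMap (X := Kified S) (Y := Kified T) f := by
  intro C hC
  refine isClosed_coinduced.2 (isClosed_sigma_iff.2 ?_)
  rintro ⟨K, g⟩
  let L : Set K := g ⁻¹' Set.range f
  have hL : IsClosed L := hf.isClosed_range.preimage g.continuous
  have : CompactSpace L := isCompact_iff_compactSpace.1 hL.isCompact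
  let g' : L → S := fun x => hf.isEmbedding.toHomeomorph.symm ⟨g x.1, x.2⟩
  have hg' : Continuous g' := hf.isEmbedding.toHomeomorph.symm.continuous.comp (by fun_prop)
  have fg' (x : L) : f (g' x) = g x.1 :=
    congrArg Subtype.val (hf.isEmbedding.toHomeomorph.apply_symm_apply ⟨g x.1, x.2⟩)
  have hc : IsClosed (g' ⁻¹' C) := hC.preimage (continuous_to_kified hg')
  have e : (fun x : K => g x) ⁻¹' (f '' C) = Subtype.val '' (g' ⁻¹' C) := by
    ext x
    constructor
    · rintro ⟨s, hs, hx⟩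
      refine ⟨⟨x, ⟨s, hx⟩⟩, ?_, rfl⟩
      have : g' ⟨x, ⟨s, hx⟩⟩ = s := hf.injective ((fg' ⟨x, ⟨s, hx⟩⟩).trans hx.symm)
      exact (congrArg (· ∈ C) this).mpr hs
    · rintro ⟨y, hy, rfl⟩
      exact ⟨g' y, hy, fg' y⟩
  exact e ▸ hL.isClosedEmbedding_subtypeVal.isClosedMap _ hc

/-- A Strøm structure is one for the compactly generated topology. -/
def StromData.kified {S : Type u} [TopologicalSpace S] {A : Set S} (D : StromData A) :
    StromData (X := Kified S) A where
  isClosed := D.isClosed.preimage (continuous_of_kified S)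
  u := ⟨D.u, D.u.continuous.comp (continuous_of_kified S)⟩
  h := ⟨D.h, continuous_kified_prod D.h.continuous⟩
  h_zero := D.h_zero
  h_of_mem := D.h_of_mem
  u_of_mem := D.u_of_mem
  h_mem := D.h_mem

/-! ### Strøm structures on polyhedral products -/

theorem continuous_polySet_apply (X : Fin m → PowerCouple.{u}) (σ : Finset (Fin m)) (i : Fin m) :
    Continuous fun x : polySet X σ => x.1 i :=
  (continuous_apply i).comp continuous_subtype_val

/-- The points of `(X, A)^σ` that lie in its boundary. -/
def polyBoundary (X : Fin m → PowerCouple.{u}) (σ : Finset (Fin m)) : Set (polySet X σ) :=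
  {x | ∃ i ∈ σ, x.1 i ∈ (X i).sub}

/-- The time at which the `i`-th coordinate is deformed. -/
noncomputable def polyTime {X : Fin m → PowerCouple.{u}} (S : ∀ i, StromData (X i).sub)
    (σ : Finset (Fin m)) (i : Fin m) (x : ∀ i, X i) (t : unitInterval) : unitInterval :=
  min t ((σ.erase i).inf fun j => (S j).u (x j))

open Classical in
/-- The Strøm structure of the boundary of a product. -/
noncomputable def polyStromData {X : Fin m → PowerCouple.{u}} (S : ∀ i, StromData (X i).sub)
    (σ : Finset (Fin m)) : StromData (polyBoundary X σ) where
  isClosed := by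
    have : polyBoundary X σ = ⋃ i ∈ σ, (fun x : polySet X σ => x.1 i) ⁻¹' (X i).sub := by
      ext x
      simp [polyBoundary]
    rw [this]
    exact isClosed_biUnion_finset fun i _ => (S i).isClosed.preimage (continuous_polySet_apply X σ i)
  u := ⟨fun x => σ.inf fun i => (S i).u (x.1 i),
    Continuous.finset_inf_apply fun i _ =>
      (S i).u.continuous.comp (continuous_polySet_apply X σ i)⟩
  -- Coordinate `i` flows no longer than every other `u j` allows. If `x j` lies in `A j`, all other
  -- coordinates stop at time `0` and `x j` is fixed. If `u i` is the smallest value and is less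
  -- than `t`, coordinate `i` flows for at least the time `u i` and reaches `A i`.
  h := ⟨fun p => ⟨fun i => if i ∈ σ then (S i).h (p.1.1 i, polyTime S σ i p.1.1 p.2) else p.1.1 i,
    fun i hi => by
      refine (congrArg (· ∈ (X i).sub) (if_neg hi)).mpr (p.1.2 i hi)⟩, by
    refine Continuous.subtype_mk (continuous_pi fun i => ?_) _
    split_ifs
    · refine (S i).h.continuous.comp
        (((continuous_polySet_apply X σ i).comp continuous_fst).prodMk ?_)
      exact continuous_snd.min (Continuous.finset_inf_apply fun j _ =>
        (S j).u.continuous.comp ((continuous_polySet_apply X σ j).comp continuous_fst))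
    · exact (continuous_polySet_apply X σ i).comp continuous_fst⟩
  h_zero x := by
    refine Subtype.ext (funext fun i => ?_)
    change (if i ∈ σ then (S i).h (x.1 i, polyTime S σ i x.1 0) else x.1 i) = x.1 i
    have : polyTime S σ i x.1 0 = 0 := min_eq_left nonneg'
    rw [this, (S i).h_zero, ite_self]
  h_of_mem x hx t := by
    obtain ⟨j, hj, hx⟩ := hx
    refine Subtype.ext (funext fun i => ?_)
    change (if i ∈ σ then (S i).h (x.1 i, polyTime S σ i x.1 t) else x.1 i) = x.1 i
    split_ifs with hi
    · by_cases e : i = j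
      · subst e
        exact (S i).h_of_mem _ hx _
      · have : polyTime S σ i x.1 t = 0 := by
          refine le_antisymm ((min_le_right _ _).trans ?_) nonneg'
          refine (Finset.inf_le (Finset.mem_erase.2 ⟨Ne.symm e, hj⟩)).trans ?_
          rw [(S j).u_of_mem _ hx]
        rw [this, (S i).h_zero]
    · rfl
  u_of_mem x hx := by
    obtain ⟨j, hj, hx⟩ := hx
    refine le_antisymm ((Finset.inf_le (f := fun i => (S i).u (x.1 i)) hj).trans ?_) nonneg'
    rw [(S j).u_of_mem _ hx]
  h_mem x t ht := by
    have ht' : (σ.inf fun i => (S i).u (x.1 i)) < t := ht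
    -- For empty `σ` the infimum is the top element `1`, which no time exceeds.
    have hne : σ.Nonempty := by
      by_contra h
      have h' := Finset.not_nonempty_iff_eq_empty.1 h
      refine not_top_lt (lt_of_le_of_lt (Finset.le_inf fun i hi => ?_) ht')
      simp [h'] at hi
    obtain ⟨i, hi, e⟩ := Finset.exists_mem_eq_inf σ hne fun i => (S i).u (x.1 i)
    refine ⟨i, hi, ?_⟩
    change (if i ∈ σ then (S i).h (x.1 i, polyTime S σ i x.1 t) else x.1 i) ∈ _
    rw [if_pos hi]
    rw [e] at ht'
    refine (S i).h_mem_of_le (le_min ht'.le (Finset.le_inf fun j hj => ?_))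
      (ht'.trans_le le_one')
    rw [← e]
    exact Finset.inf_le (f := fun i => (S i).u (x.1 i)) (Finset.mem_of_mem_erase hj)

theorem toBoundary_boundaryMap (F : Finset (Fin m) ⥤ TopCat.{u}) (σ : Finset (Fin m))
    (τ : ProperFace σ) (x : F.obj τ.1) :
    boundaryMap F σ (toBoundary F σ τ x) = F.map (homOfLE τ.2.subset) x :=
  ConcreteCategory.congr_hom (WeightedSystem.toBoundary_map F σ τ) x

theorem exists_toBoundary_eq (F : Finset (Fin m) ⥤ TopCat.{u}) (σ : Finset (Fin m))
    (x : boundary F σ) : ∃ (τ : ProperFace σ) (y : F.obj τ.1), toBoundary F σ τ y = x :=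
  Concrete.colimit_exists_rep (properFaces F σ) x

theorem isClosedEmbedding_polyInclusion (X : Fin m → PowerCouple.{u})
    (hX : ∀ i, IsClosed (X i).sub) {τ σ : Finset (Fin m)} (h : τ ⊆ σ) :
    Topology.IsClosedEmbedding (fun x : polySet X τ =>
      (⟨x.1, fun i hi => x.2 i fun h' => hi (h h')⟩ : polySet X σ)) := by
  have hcl : IsClosed (polySet X τ) := by
    have : polySet X τ = ⋂ i ∈ (↑τ : Set (Fin m))ᶜ, (fun x => x i) ⁻¹' (X i).sub := by
      ext x
      simp [polySet]
    rw [this]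
    exact isClosed_biInter fun i _ => (hX i).preimage (continuous_apply i)
  exact Topology.IsClosedEmbedding.of_comp (f := fun x : polySet X τ =>
    (⟨x.1, fun i hi => x.2 i fun h' => hi (h h')⟩ : polySet X σ)) (g := Subtype.val)
    Topology.IsEmbedding.subtypeVal hcl.isClosedEmbedding_subtypeVal

theorem range_boundaryMap_poly (X : Fin m → PowerCouple.{u}) (σ : Finset (Fin m)) :
    Set.range (boundaryMap (polyFunctor X) σ) = polyBoundary X σ := by
  ext x
  constructor
  · rintro ⟨y, rfl⟩
    obtain ⟨τ, y, rfl⟩ := exists_toBoundary_eq _ _ y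
    rw [toBoundary_boundaryMap]
    obtain ⟨i, hi, hi'⟩ := Finset.exists_of_ssubset τ.2
    exact ⟨i, hi, y.2 i hi'⟩
  · rintro ⟨i, hi, hx⟩
    let τ : ProperFace σ := ⟨σ.erase i, Finset.erase_ssubset hi⟩
    let y : polySet X τ.1 := ⟨x.1, fun j hj => by
      by_cases e : j = i
      · subst e
        exact hx
      · exact x.2 j fun hj' => hj (Finset.mem_erase.2 ⟨e, hj'⟩)⟩
    exact ⟨toBoundary (polyFunctor X) σ τ y,
      toBoundary_boundaryMap (polyFunctor X) σ τ y⟩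

/-- If points of $(X,A)^\tau$ and $(X,A)^{\tau'}$ agree in the product, they come from
$(X,A)^{\tau\cap\tau'}$ and are already identified in the colimit. -/
theorem injective_boundaryMap_poly (X : Fin m → PowerCouple.{u}) (σ : Finset (Fin m)) :
    Function.Injective (boundaryMap (polyFunctor X) σ) := by
  intro x x' e
  obtain ⟨τ, y, rfl⟩ := exists_toBoundary_eq _ _ x
  obtain ⟨τ', y', rfl⟩ := exists_toBoundary_eq _ _ x'
  rw [toBoundary_boundaryMap, toBoundary_boundaryMap] at e
  have e' : y.1 = y'.1 := congrArg (fun z : polySet X σ => z.1) e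
  let μ : ProperFace σ := ⟨τ.1 ∩ τ'.1,
    Finset.ssubset_of_subset_of_ssubset Finset.inter_subset_left τ.2⟩
  let z : polySet X μ.1 := ⟨y.1, fun i hi => by
    by_cases hi' : i ∈ τ.1
    · rw [e']
      exact y'.2 i fun h => hi (Finset.mem_inter.2 ⟨hi', h⟩)
    · exact y.2 i hi'⟩
  have h₁ := ConcreteCategory.congr_hom (WeightedSystem.toBoundary_w (polyFunctor X) σ τ μ
    Finset.inter_subset_left) z
  have h₂ := ConcreteCategory.congr_hom (WeightedSystem.toBoundary_w (polyFunctor X) σ τ' μ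
    Finset.inter_subset_right) z
  have hy : (polyFunctor X).map (homOfLE Finset.inter_subset_left : μ.1 ⟶ τ.1) z = y := rfl
  have hy' : (polyFunctor X).map (homOfLE Finset.inter_subset_right : μ.1 ⟶ τ'.1) z = y' :=
    Subtype.ext e'
  rw [← hy, ← hy']
  exact h₁.trans h₂.symm

/-- The image of a closed set is a finite union of closed sets, one from each proper face. With
injectivity, this identifies the colimit topology of the boundary with the subspace topology. -/
theorem isClosedMap_boundaryMap_poly (X : Fin m → PowerCouple.{u}) (hX : ∀ i, IsClosed (X i).sub)
    (σ : Finset (Fin m)) : IsClosedMap (boundaryMap (polyFunctor X) σ) := by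
  intro C hC
  have : boundaryMap (polyFunctor X) σ '' C = ⋃ τ : ProperFace σ,
      (polyFunctor X).map (homOfLE τ.2.subset) '' (toBoundary (polyFunctor X) σ τ ⁻¹' C) := by
    ext x
    simp only [Set.mem_image, Set.mem_iUnion]
    constructor
    · rintro ⟨y, hy, rfl⟩
      obtain ⟨τ, y, rfl⟩ := exists_toBoundary_eq _ _ y
      exact ⟨τ, y, hy, (toBoundary_boundaryMap _ σ τ y).symm⟩
    · rintro ⟨τ, y, hy, rfl⟩
      exact ⟨_, hy, toBoundary_boundaryMap _ σ τ y⟩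
  rw [this]
  refine isClosed_iUnion_of_finite fun τ => ?_
  refine isClosedMap_kified (isClosedEmbedding_polyInclusion X hX τ.2.subset) _ ?_
  exact hC.preimage (toBoundary (polyFunctor X) σ τ).hom.continuous

/-- The inclusion of the boundary in a polyhedral product is a cofibration. -/
theorem hep_boundaryMap_poly {X : Fin m → PowerCouple.{u}} (S : ∀ i, StromData (X i).sub)
    (σ : Finset (Fin m)) : HEP (boundaryMap (polyFunctor X) σ) := by
  have D : StromData (X := polyObj X σ) (polyBoundary X σ) := (polyStromData S σ).kified
  rw [← range_boundaryMap_poly] at D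
  refine D.hep (.of_continuous_injective_isClosedMap ?_ (injective_boundaryMap_poly X σ)
    (isClosedMap_boundaryMap_poly X (fun i => (S i).isClosed) σ))
  exact (boundaryMap (polyFunctor X) σ).hom.continuous


/-! ### Colimits over sets of faces -/

/-- The restriction of a functor on the faces of the simplex to the faces that satisfy `K`. -/
abbrev facesOn (F : Finset (Fin m) ⥤ TopCat.{u}) (K : Finset (Fin m) → Prop) :
    {τ : Finset (Fin m) // K τ} ⥤ TopCat.{u} :=
  (Subtype.mono_coe K).functor ⋙ F

/-- The colimit over the faces that satisfy `K`. -/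
noncomputable def colimOn (F : Finset (Fin m) ⥤ TopCat.{u}) (K : Finset (Fin m) → Prop) :
    TopCat.{u} :=
  colimit (facesOn F K)

section ColimOn

variable (F G : Finset (Fin m) ⥤ TopCat.{u}) (K : Finset (Fin m) → Prop)

/-- The map from the value at a face to the colimit. -/
noncomputable def toColimOn (τ : Finset (Fin m)) (hτ : K τ) : F.obj τ ⟶ colimOn F K :=
  colimit.ι (facesOn F K) ⟨τ, hτ⟩

variable {F G K}

theorem toColimOn_w {μ τ : Finset (Fin m)} (h : μ ⊆ τ) (hμ : K μ) (hτ : K τ) :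
    F.map (homOfLE h) ≫ toColimOn F K τ hτ = toColimOn F K μ hμ :=
  colimit.w (facesOn F K) (homOfLE h : (⟨μ, hμ⟩ : {τ // K τ}) ⟶ ⟨τ, hτ⟩)

theorem colimOn_ext {Z : TopCat.{u}} {f g : colimOn F K ⟶ Z}
    (h : ∀ τ hτ, toColimOn F K τ hτ ≫ f = toColimOn F K τ hτ ≫ g) : f = g :=
  colimit.hom_ext fun τ => h τ.1 τ.2

/-- The universal property of the colimit. -/
noncomputable def colimOnDesc {Z : TopCat.{u}} (f : ∀ τ, K τ → (F.obj τ ⟶ Z))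
    (hf : ∀ μ τ (h : μ ⊆ τ) (hμ : K μ) (hτ : K τ), F.map (homOfLE h) ≫ f τ hτ = f μ hμ) :
    colimOn F K ⟶ Z :=
  colimit.desc (facesOn F K)
    { pt := Z
      ι :=
        { app := fun τ => f τ.1 τ.2
          naturality := fun μ τ h => (hf μ.1 τ.1 (leOfHom h) μ.2 τ.2).trans
            (Category.comp_id _).symm } }

theorem toColimOn_desc {Z : TopCat.{u}} (f : ∀ τ, K τ → (F.obj τ ⟶ Z)) (hf) (τ) (hτ : K τ) :
    toColimOn F K τ hτ ≫ colimOnDesc f hf = f τ hτ :=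
  colimit.ι_desc _ _

variable (K) in
/-- The map of colimits that is induced by a natural transformation. -/
noncomputable def colimOnMap (α : F ⟶ G) : colimOn F K ⟶ colimOn G K :=
  colimOnDesc (fun τ hτ => α.app τ ≫ toColimOn G K τ hτ) fun μ τ h hμ hτ => by
    rw [← Category.assoc, α.naturality, Category.assoc, toColimOn_w h hμ hτ]

theorem toColimOn_map (α : F ⟶ G) (τ) (hτ : K τ) :
    toColimOn F K τ hτ ≫ colimOnMap K α = α.app τ ≫ toColimOn G K τ hτ :=
  toColimOn_desc _ _ _ _

/-- The map of boundaries that is induced by a natural transformation. -/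
noncomputable def boundaryTrans (α : F ⟶ G) (σ : Finset (Fin m)) : boundary F σ ⟶ boundary G σ :=
  colimOnMap (· ⊂ σ) α

theorem toBoundary_trans (α : F ⟶ G) {σ : Finset (Fin m)} (τ : ProperFace σ) :
    toBoundary F σ τ ≫ boundaryTrans α σ = α.app τ.1 ≫ toBoundary G σ τ :=
  toColimOn_map (K := (· ⊂ σ)) α τ.1 τ.2

/-- A natural homotopy induces a homotopy on colimits. -/
theorem htp_colimOn {f : colimOn F K ⟶ colimOn G K} {g : colimOn F K ⟶ colimOn G K}
    {α β : ∀ τ, F.obj τ ⟶ G.obj τ} (H : ∀ τ, F.obj τ ⟶ Pth (G.obj τ))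
    (hH : ∀ μ τ (h : μ ⊆ τ), F.map (homOfLE h) ≫ H τ = H μ ≫ pmap (G.map (homOfLE h)))
    (H₀ : ∀ τ, H τ ≫ ev _ 0 = α τ) (H₁ : ∀ τ, H τ ≫ ev _ 1 = β τ)
    (hf : ∀ τ hτ, toColimOn F K τ hτ ≫ f = α τ ≫ toColimOn G K τ hτ)
    (hg : ∀ τ hτ, toColimOn F K τ hτ ≫ g = β τ ≫ toColimOn G K τ hτ) : Htp f g := by
  refine ⟨colimOnDesc (fun τ hτ => H τ ≫ pmap (toColimOn G K τ hτ)) ?_, colimOn_ext ?_,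
    colimOn_ext ?_⟩
  · intro μ τ h hμ hτ
    rw [← Category.assoc, hH, Category.assoc, ← pmap_comp, toColimOn_w h hμ hτ]
  · intro τ hτ
    rw [← Category.assoc, toColimOn_desc, Category.assoc, pmap_ev, ← Category.assoc, H₀, hf]
  · intro τ hτ
    rw [← Category.assoc, toColimOn_desc, Category.assoc, pmap_ev, ← Category.assoc, H₁, hg]

end ColimOn

/-! ### Maps and homotopies of polyhedral products -/

section Poly

variable {X Y : Fin m → PowerCouple.{u}}

/-- The homotopy of maps `(X, A)^σ → (Y, B)^σ` that is the product of homotopies. -/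
noncomputable def polyHtp (H : ∀ i, C(X i × unitInterval, Y i))
    (hH : ∀ i t, ∀ x ∈ (X i).sub, H i (x, t) ∈ (Y i).sub) (σ : Finset (Fin m)) :
    (polyFunctor X).obj σ ⟶ Pth ((polyFunctor Y).obj σ) :=
  curryPth (X := polyObj X σ) (Z := polyObj Y σ)
    (fun p => (⟨fun i => H i ((show polySet X σ from p.1).1 i, p.2),
      fun i hi => hH i p.2 _ ((show polySet X σ from p.1).2 i hi)⟩ : polySet Y σ))
    (continuous_kified_prod (S := polySet X σ) (T := polySet Y σ)
      (Continuous.subtype_mk (continuous_pi fun i => (H i).continuous.comp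
        (((continuous_polySet_apply X σ i).comp continuous_fst).prodMk continuous_snd)) _))

theorem polyHtp_natural (H : ∀ i, C(X i × unitInterval, Y i)) (hH) {μ τ : Finset (Fin m)}
    (h : μ ⊆ τ) : (polyFunctor X).map (homOfLE h) ≫ polyHtp H hH τ =
      polyHtp H hH μ ≫ pmap ((polyFunctor Y).map (homOfLE h)) := rfl

/-- The product of maps of pairs, as a natural transformation. -/
def polyTrans (g : ∀ i, C(X i, Y i)) (hg : ∀ i, Set.MapsTo (g i) (X i).sub (Y i).sub) :
    polyFunctor X ⟶ polyFunctor Y where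
  app σ := kMap
    (fun x : polySet X σ => (⟨fun i => g i (x.1 i), fun i hi => hg i (x.2 i hi)⟩ : polySet Y σ))
    (by
      refine Continuous.subtype_mk (continuous_pi fun i => ?_) _
      exact (g i).continuous.comp (continuous_polySet_apply X σ i))
  naturality _ _ _ := rfl

/-- The product homotopy is natural in the face, so it descends to every colimit of faces.
Compatibility with power maps plays no role for these unweighted spaces. -/
theorem htp_polyTrans {f g : ∀ i, C(X i, X i)} (hf hg) (H : ∀ i, (f i).Homotopy (g i))
    (hH : ∀ i t, ∀ x ∈ (X i).sub, H i (t, x) ∈ (X i).sub) :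
    (∀ σ, Htp ((polyTrans f hf).app σ) ((polyTrans g hg).app σ)) ∧
      ∀ K, Htp (colimOnMap K (polyTrans f hf)) (colimOnMap K (polyTrans g hg)) := by
  let H' : ∀ i, C(X i × unitInterval, X i) := fun i =>
    (H i).toContinuousMap.comp ⟨Prod.swap, continuous_swap⟩
  have e₀ (σ) : polyHtp H' (fun i t => hH i t) σ ≫ ev _ 0 = (polyTrans f hf).app σ := by
    refine TopCat.ext fun x => Subtype.ext (funext fun i => ?_)
    exact (H i).apply_zero _
  have e₁ (σ) : polyHtp H' (fun i t => hH i t) σ ≫ ev _ 1 = (polyTrans g hg).app σ := by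
    refine TopCat.ext fun x => Subtype.ext (funext fun i => ?_)
    exact (H i).apply_one _
  exact ⟨fun σ => ⟨_, e₀ σ, e₁ σ⟩, fun K => htp_colimOn (polyHtp H' fun i t => hH i t)
    (fun _ _ h => polyHtp_natural _ _ h) e₀ e₁ (fun _ _ => toColimOn_map _ _ _)
    fun _ _ => toColimOn_map _ _ _⟩

theorem colimOnMap_id (F : Finset (Fin m) ⥤ TopCat.{u}) (K) : colimOnMap K (𝟙 F) = 𝟙 _ :=
  colimOn_ext fun τ hτ => by
    rw [toColimOn_map, NatTrans.id_app, Category.id_comp, Category.comp_id]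

theorem colimOnMap_comp {F G H : Finset (Fin m) ⥤ TopCat.{u}} (K) (α : F ⟶ G) (β : G ⟶ H) :
    colimOnMap K (α ≫ β) = colimOnMap K α ≫ colimOnMap K β :=
  colimOn_ext fun τ hτ => by
    rw [toColimOn_map, ← Category.assoc, toColimOn_map, Category.assoc, toColimOn_map,
      NatTrans.comp_app, Category.assoc]

/-- The natural transformation of polyhedral products given by maps between power couples. -/
abbrev polyMapTrans (φ : ∀ i, (X i).Hom (Y i)) : polyFunctor X ⟶ polyFunctor Y :=
  polyTrans (fun i => (φ i).map) fun i => (φ i).isMapOfPairs.mapsTo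

/-- A product of homotopy equivalences of pairs is a homotopy equivalence, with a pointed
homotopy inverse. -/
theorem exists_polyMap_inverse {φ : ∀ i, (X i).Hom (Y i)} (hφ : ∀ i, (φ i).IsHomotopyEquiv) :
    ∃ γ : polyFunctor Y ⟶ polyFunctor X,
      (∀ σ, γ.app σ (polyBase Y σ) = polyBase X σ) ∧
      (∀ σ, Htp (𝟙 _) (polyMap φ σ ≫ γ.app σ) ∧ Htp (𝟙 _) (γ.app σ ≫ polyMap φ σ)) ∧
      ∀ K, HE (colimOnMap K (polyMapTrans φ)) := by
  choose _ g hg hH hK using hφ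
  choose H hH using hH
  choose K hK using hK
  have hX := htp_polyTrans (f := fun i => .id (X i)) (fun i => Set.mapsTo_id _)
    (fun i x hx => (hg i).mapsTo ((φ i).isMapOfPairs.mapsTo hx)) H hH
  have hY := htp_polyTrans (f := fun i => .id (Y i)) (fun i => Set.mapsTo_id _)
    (fun i x hx => (φ i).isMapOfPairs.mapsTo ((hg i).mapsTo hx)) K hK
  refine ⟨polyTrans g fun i => (hg i).mapsTo, fun σ => ?_, fun σ => ⟨hX.1 σ, hY.1 σ⟩, fun S =>
    ⟨colimOnMap S (polyTrans g fun i => (hg i).mapsTo), ?_, ?_⟩⟩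
  · exact Subtype.ext (funext fun i => (hg i).map_base)
  · rw [← colimOnMap_id, ← colimOnMap_comp]
    exact hX.2 S
  · rw [← colimOnMap_id, ← colimOnMap_comp]
    exact hY.2 S

end Poly

end TopHtpy

open TopHtpy

namespace WeightedSystem

/-! ### The universal property of the spaces of a weighted system -/

section Universal

variable {X : Fin m → PowerCouple.{u}} {c : PowerSequence m} (W : WeightedSystem X c)

/-- For `σ = ∅` both boundaries are empty colimits and `η` is an isomorphism, so the square is a
pushout as well. Inductions over faces then need no special case. -/
theorem isPushout_boundaryMap (σ : Finset (Fin m)) :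
    IsPushout (boundaryMap (polyFunctor X) σ) (W.ηBoundary σ) (W.η σ)
      (boundaryMap W.functor σ) := by
  rcases σ.eq_empty_or_nonempty with rfl | h
  · have := W.isIso_η_empty
    have no (τ : Finset (Fin m)) (h : τ ⊂ ∅) : False := Finset.not_ssubset_empty τ h
    have : IsIso (W.ηBoundary ∅) := by
      let g : boundary W.functor ∅ ⟶ boundary (polyFunctor X) ∅ :=
        colimOnDesc (K := (· ⊂ ∅)) (fun τ hτ => (no τ hτ).elim) fun _ _ _ hμ => (no _ hμ).elim
      exact ⟨g, boundary_ext fun τ => (no _ τ.2).elim, boundary_ext fun τ => (no _ τ.2).elim⟩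
    exact IsPushout.of_vert_isIso ⟨boundary_ext fun τ => (no _ τ.2).elim⟩
  · exact W.isPushout σ h

theorem incl_rfl (σ : Finset (Fin m)) : W.incl (subset_refl σ) = 𝟙 (W.obj σ) :=
  W.functor.map_id σ

theorem incl_comp {μ τ σ : Finset (Fin m)} (h : μ ⊆ τ) (h' : τ ⊆ σ) :
    W.incl h ≫ W.incl h' = W.incl (h.trans h') :=
  (W.functor.map_comp (homOfLE h) (homOfLE h')).symm

/-- For `μ ≠ τ` this is the commutativity of the pushout square at `τ`, restricted to the part of
the boundary given by `μ`. -/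
theorem map_η {μ τ : Finset (Fin m)} (h : μ ⊆ τ) :
    (polyFunctor X).map (homOfLE h) ≫ W.η τ = polyPow X (c.ratio τ μ) μ ≫ W.η μ ≫ W.incl h := by
  by_cases e : μ = τ
  · subst e
    rw [polyPow_one X _ _ (ratio_self c _), incl_rfl, Category.id_comp, Category.comp_id]
    exact Category.id_comp (W.η μ)
  · have := toBoundary (polyFunctor X) τ ⟨μ, ssub h e⟩ ≫= (W.isPushout_boundaryMap τ).w
    rw [← Category.assoc, toBoundary_map, ← Category.assoc, W.toBoundary_ηBoundary, Category.assoc,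
      Category.assoc, toBoundary_map] at this
    exact this

/-- Unwinding the pushouts down through the proper faces shows that the maps `η τ ≫ incl` are
jointly epimorphic. With `exists_desc`, any weighted system has the universal property of the
explicit quotient. -/
theorem obj_ext {σ : Finset (Fin m)} {Z : TopCat.{u}} {f g : W.obj σ ⟶ Z}
    (h : ∀ τ (h : τ ⊆ σ), W.η τ ≫ W.incl h ≫ f = W.η τ ≫ W.incl h ≫ g) : f = g := by
  induction σ using Finset.strongInduction with
  | H σ ih =>
    refine (W.isPushout_boundaryMap σ).hom_ext ?_ (boundary_ext fun τ => ?_)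
    · simpa only [incl_rfl, Category.id_comp] using h σ subset_rfl
    · rw [← Category.assoc, ← Category.assoc, toBoundary_map]
      refine ih τ.1 τ.2 fun μ hμ => ?_
      have := h μ (hμ.trans τ.2.subset)
      rwa [← W.incl_comp hμ τ.2.subset, Category.assoc, Category.assoc] at this

theorem exists_desc {σ : Finset (Fin m)} {Z : TopCat.{u}}
    (f : ∀ τ, τ ⊆ σ → ((polyFunctor X).obj τ ⟶ Z))
    (hf : ∀ μ τ (h : μ ⊆ τ) (h' : τ ⊆ σ), (polyFunctor X).map (homOfLE h) ≫ f τ h' =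
      polyPow X (c.ratio τ μ) μ ≫ f μ (h.trans h')) :
    ∃ d : W.obj σ ⟶ Z, ∀ τ (h : τ ⊆ σ), W.η τ ≫ W.incl h ≫ d = f τ h := by
  induction σ using Finset.strongInduction with
  | H σ ih =>
    have ih' (τ : Finset (Fin m)) (hτ : τ ⊂ σ) :=
      ih τ hτ (fun μ h => f μ (h.trans hτ.subset)) fun μ ν h h' => hf μ ν h (h'.trans hτ.subset)
    choose d hd using ih'
    -- The inductively chosen maps on the proper faces are compatible because `obj_ext` makes each
    -- of them unique.
    let dB : boundary W.functor σ ⟶ Z := colimOnDesc (K := (· ⊂ σ)) d fun μ τ h hμ hτ =>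
      W.obj_ext fun ν hν => by
        rw [hd, ← Category.assoc (W.incl hν)]
        exact (congrArg (W.η ν ≫ · ≫ d τ hτ) (W.incl_comp hν h)).trans (hd τ hτ ν (hν.trans h))
    have hdB (τ : ProperFace σ) : toBoundary W.functor σ τ ≫ dB = d τ.1 τ.2 :=
      toColimOn_desc (K := (· ⊂ σ)) _ _ _ _
    have e : boundaryMap (polyFunctor X) σ ≫ f σ subset_rfl = W.ηBoundary σ ≫ dB :=
      boundary_ext fun τ => by
        rw [← Category.assoc, toBoundary_map, ← Category.assoc, W.toBoundary_ηBoundary,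
          Category.assoc, Category.assoc, hdB, hf τ.1 σ τ.2.subset subset_rfl]
        have := hd τ.1 τ.2 τ.1 subset_rfl
        rw [incl_rfl, Category.id_comp] at this
        rw [this]
    refine ⟨(W.isPushout_boundaryMap σ).desc _ dB e, fun τ h => ?_⟩
    by_cases e' : τ = σ
    · subst e'
      rw [incl_rfl, Category.id_comp, IsPushout.inl_desc]
    · have h₁ := toBoundary_map W.functor σ ⟨τ, ssub h e'⟩
      have h₂ : W.incl h = toBoundary W.functor σ ⟨τ, ssub h e'⟩ ≫ boundaryMap W.functor σ :=
        h₁.symm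
      rw [h₂, Category.assoc, IsPushout.inr_desc, hdB]
      have := hd τ (ssub h e') τ subset_rfl
      rwa [incl_rfl, Category.id_comp] at this

end Universal

/-! ### The induced maps -/

section Map

variable {X Y : Fin m → PowerCouple.{u}} {c : PowerSequence m} (W : WeightedSystem X c)
  (V : WeightedSystem Y c) (φ : ∀ i, (X i).Hom (Y i))

theorem polyPow_polyMap (a : Fin m → ℕ+) (σ : Finset (Fin m)) :
    polyPow X a σ ≫ polyMap φ σ = polyMap φ σ ≫ polyPow Y a σ :=
  TopCat.ext fun x => Subtype.ext (funext fun i =>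
    congrArg (fun f : C(X i, Y i) => f ((show polySet X σ from x).1 i)) ((φ i).comm (a i)))

theorem polyInclusion_polyMap {μ τ : Finset (Fin m)} (h : μ ⊆ τ) :
    (polyFunctor X).map (homOfLE h) ≫ polyMap φ τ =
      polyMap φ μ ≫ (polyFunctor Y).map (homOfLE h) := rfl

theorem exists_trans : ∃ Φ : W.functor ⟶ V.functor,
    ∀ σ, W.η σ ≫ Φ.app σ = polyMap φ σ ≫ V.η σ := by
  -- The family satisfies the gluing relation because `map_η` holds in `V` and the `φ i` commute
  -- with the power maps.
  have key (σ) := W.exists_desc (σ := σ) (fun τ h => polyMap φ τ ≫ V.η τ ≫ V.incl h)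
    fun μ τ h h' => by
      rw [reassoc_of% polyInclusion_polyMap φ h, ← Category.assoc _ (V.η τ), V.map_η h,
        Category.assoc, Category.assoc, V.incl_comp, reassoc_of% polyPow_polyMap φ]
  choose Φ hΦ using key
  refine ⟨⟨Φ, fun τ σ h => W.obj_ext fun μ hμ => ?_⟩, fun σ => ?_⟩
  · have h' : τ ⊆ σ := leOfHom h
    rw [← Category.assoc (W.incl hμ), reassoc_of% hΦ τ μ hμ]
    exact (congrArg (W.η μ ≫ · ≫ Φ σ) (W.incl_comp hμ h')).trans ((hΦ σ μ (hμ.trans h')).trans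
      (congrArg (polyMap φ μ ≫ V.η μ ≫ ·) (V.incl_comp hμ h').symm))
  · have := hΦ σ σ subset_rfl
    rwa [incl_rfl, Category.id_comp, incl_rfl, Category.comp_id] at this

variable {W V}

theorem trans_unique {Φ Ψ : ∀ σ, W.obj σ ⟶ V.obj σ}
    (h : ∀ τ σ (h : τ ⊆ σ), W.incl h ≫ Φ σ = Φ τ ≫ V.incl h)
    (h' : ∀ τ σ (h : τ ⊆ σ), W.incl h ≫ Ψ σ = Ψ τ ≫ V.incl h)
    (e : ∀ σ, W.η σ ≫ Φ σ = W.η σ ≫ Ψ σ) : Φ = Ψ :=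
  funext fun σ => W.obj_ext fun τ hτ => by
    rw [h, h', reassoc_of% e]

theorem incl_app (Φ : W.functor ⟶ V.functor) {τ σ : Finset (Fin m)} (h : τ ⊆ σ) :
    W.incl h ≫ Φ.app σ = Φ.app τ ≫ V.incl h :=
  Φ.naturality (homOfLE h)

variable {φ} in
theorem app_base {Φ : W.functor ⟶ V.functor}
    (hΦ : ∀ σ, W.η σ ≫ Φ.app σ = polyMap φ σ ≫ V.η σ) (σ) : Φ.app σ (W.base σ) = V.base σ := by
  rw [← W.η_base, ← V.η_base]
  refine (ConcreteCategory.congr_hom (hΦ σ) _).trans (congrArg (V.η σ) ?_)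
  exact Subtype.ext (funext fun i => (φ i).isMapOfPairs.map_base)

theorem app_mapsTo_faceSet (Φ : W.functor ⟶ V.functor) {τ σ : Finset (Fin m)} (h : τ ⊆ σ) :
    Set.MapsTo (Φ.app σ) (W.faceSet h) (V.faceSet h) := by
  rintro _ ⟨x, rfl⟩
  exact ⟨Φ.app τ x, (ConcreteCategory.congr_hom (incl_app Φ h) x).symm⟩

theorem _root_.TopHtpy.boundaryMap_app {F G : Finset (Fin m) ⥤ TopCat.{u}} (α : F ⟶ G)
    (σ : Finset (Fin m)) :
    boundaryMap F σ ≫ α.app σ = boundaryTrans α σ ≫ boundaryMap G σ :=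
  boundary_ext fun τ => by
    rw [← Category.assoc, toBoundary_map, ← Category.assoc, toBoundary_trans, Category.assoc,
      toBoundary_map, α.naturality]

theorem app_mapsTo_boundarySet (Φ : W.functor ⟶ V.functor) (σ : Finset (Fin m)) :
    Set.MapsTo (Φ.app σ) (W.boundarySet σ) (V.boundarySet σ) := by
  rintro _ ⟨x, rfl⟩
  exact ⟨_, (ConcreteCategory.congr_hom (boundaryMap_app Φ σ) x).symm⟩

/-- The inverse of a homeomorphism of power couples. -/
theorem _root_.PowerCouple.Hom.IsHomeomorphism.exists_inverse {P Q : PowerCouple.{u}} {f : P.Hom Q}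
    (h : f.IsHomeomorphism) : ∃ g : Q.Hom P, (∀ x, g.map (f.map x) = x) ∧
      ∀ y, f.map (g.map y) = y := by
  obtain ⟨-, g, hg, h₁, h₂⟩ := h
  have h₁' (x) : g (f.map x) = x := congrArg (fun k : C(P, P) => k x) h₁
  have h₂' (y) : f.map (g y) = y := congrArg (fun k : C(Q, Q) => k y) h₂
  -- The inverse commutes with the power maps: apply `g` to the relation for `f` at the point `g y`.
  refine ⟨⟨g, hg, fun a => ContinuousMap.ext fun y => ?_⟩, h₁', h₂'⟩
  have := congrArg (fun k : C(P, Q) => k (g y)) (f.comm a)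
  change f.map (P.pow a (g y)) = Q.pow a (f.map (g y)) at this
  change g (Q.pow a y) = P.pow a (g y)
  rw [h₂'] at this
  rw [← this, h₁']

variable {φ} in
theorem comp_eq_id {ψ : ∀ i, (Y i).Hom (X i)} {Φ : W.functor ⟶ V.functor}
    {Ψ : V.functor ⟶ W.functor} (hΦ : ∀ σ, W.η σ ≫ Φ.app σ = polyMap φ σ ≫ V.η σ)
    (hΨ : ∀ σ, V.η σ ≫ Ψ.app σ = polyMap ψ σ ≫ W.η σ)
    (h : ∀ i x, (ψ i).map ((φ i).map x) = x) (σ) : Φ.app σ ≫ Ψ.app σ = 𝟙 _ := by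
  have e (σ) : polyMap φ σ ≫ polyMap ψ σ = 𝟙 _ :=
    TopCat.ext fun x => Subtype.ext (funext fun i => h i _)
  refine congrFun (trans_unique (W := W) (V := W) (Φ := fun σ => (Φ ≫ Ψ).app σ)
    (Ψ := fun σ => 𝟙 _) (fun τ σ h => incl_app _ h) (fun τ σ h => ?_) fun σ => ?_) σ
  · rw [Category.comp_id, Category.id_comp]
  · rw [NatTrans.comp_app, reassoc_of% hΦ σ, hΨ, reassoc_of% e σ, Category.comp_id]

end Map

end WeightedSystem

namespace TopHtpy

/-! ### Attaching a face to a colimit over a complex -/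

/-- A set of faces that contains the faces of its members. -/
def IsComplex (K : Finset (Fin m) → Prop) : Prop := ∀ μ τ, μ ⊆ τ → K τ → K μ

theorem isComplex_ssubset (σ : Finset (Fin m)) : IsComplex (· ⊂ σ) := fun _ _ h h' =>
  Finset.ssubset_of_subset_of_ssubset h h'

theorem isComplex_subset (σ : Finset (Fin m)) : IsComplex (· ⊆ σ) := fun _ _ h h' => h.trans h'

/-- Induction over the complexes that contain a given one, adding one face at a time. -/
theorem IsComplex.induction {K : Finset (Fin m) → Prop} (hK : IsComplex K)
    {P : (Finset (Fin m) → Prop) → Prop} (base : P K)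
    (step : ∀ L σ, IsComplex L → L σ → IsComplex (fun τ => L τ ∧ τ ≠ σ) →
      (∀ τ, K τ → L τ ∧ τ ≠ σ) → P (fun τ => L τ ∧ τ ≠ σ) → P L)
    {L : Finset (Fin m) → Prop} (hL : IsComplex L) (hKL : ∀ τ, K τ → L τ) : P L := by
  classical
  induction h : (Finset.univ.filter L).card using Nat.strong_induction_on generalizing L with
  | _ n ih =>
    by_cases e : ∀ τ, L τ → K τ
    · obtain rfl : K = L := funext fun τ => propext ⟨hKL τ, e τ⟩
      exact base
    · push Not at e
      obtain ⟨τ₀, hτ₀⟩ := e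
      -- A face that is maximal in `L` outside `K` is maximal in all of `L`, since a larger face in
      -- `K` would force it into `K`. Removing it leaves a complex that contains `K`.
      obtain ⟨σ, hσ⟩ := (Finset.univ.filter fun τ => L τ ∧ ¬ K τ).exists_maximal
        ⟨τ₀, by simpa using hτ₀⟩
      have hσ' : L σ ∧ ¬ K σ := by simpa using hσ.prop
      have hmax (τ) (hτ : L τ) (h : σ ⊆ τ) : τ = σ :=
        subset_antisymm (hσ.2 (by simpa using ⟨hτ, fun h' => hσ'.2 (hK _ _ h h')⟩) h) h
      have hL' : IsComplex fun τ => L τ ∧ τ ≠ σ := fun μ τ h hτ =>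
        ⟨hL μ τ h hτ.1, fun e => hτ.2 (hmax τ hτ.1 (e ▸ h))⟩
      have hKL' (τ) (hτ : K τ) : L τ ∧ τ ≠ σ := ⟨hKL τ hτ, fun e => hσ'.2 (e ▸ hτ)⟩
      refine step L σ hL hσ'.1 hL' hKL' (ih _ ?_ hL' hKL' rfl)
      rw [← h]
      refine Finset.card_lt_card (Finset.ssubset_iff_of_subset ?_ |>.2 ⟨σ, ?_, ?_⟩)
      · intro τ hτ
        simp only [Finset.mem_filter, Finset.mem_univ, true_and] at hτ ⊢
        exact hτ.1
      · simpa using hσ'.1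
      · simp

variable {F : Finset (Fin m) ⥤ TopCat.{u}} {K L : Finset (Fin m) → Prop}

/-- The map of colimits for an inclusion of sets of faces. -/
noncomputable def colimOnIncl (F : Finset (Fin m) ⥤ TopCat.{u}) (h : ∀ τ, K τ → L τ) :
    colimOn F K ⟶ colimOn F L :=
  colimOnDesc (fun τ hτ => toColimOn F L τ (h τ hτ)) fun _ _ h' _ _ => toColimOn_w h' _ _

theorem toColimOn_incl (h : ∀ τ, K τ → L τ) (τ) (hτ : K τ) :
    toColimOn F K τ hτ ≫ colimOnIncl F h = toColimOn F L τ (h τ hτ) :=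
  toColimOn_desc _ _ _ _

/-- The map from the boundary of a face to the colimit over a set of faces that contains the
boundary. -/
noncomputable def boundaryToColimOn (F : Finset (Fin m) ⥤ TopCat.{u}) {σ : Finset (Fin m)}
    (h : ∀ τ, τ ⊂ σ → K τ) : boundary F σ ⟶ colimOn F K :=
  colimOnIncl F (K := (· ⊂ σ)) h

theorem toBoundary_toColimOn {σ : Finset (Fin m)} (h : ∀ τ, τ ⊂ σ → K τ) (τ : ProperFace σ) :
    toBoundary F σ τ ≫ boundaryToColimOn F h = toColimOn F K τ.1 (h τ.1 τ.2) :=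
  toColimOn_incl (K := (· ⊂ σ)) h τ.1 τ.2

open Classical in
/-- The colimit over a complex with a maximal face `σ` is obtained by attaching the value
at `σ` to the colimit over the other faces. -/
theorem isPushout_colimOn {σ : Finset (Fin m)} (hL : L σ) (hL' : IsComplex fun τ => L τ ∧ τ ≠ σ)
    (h : ∀ τ, τ ⊂ σ → L τ ∧ τ ≠ σ) :
    IsPushout (boundaryMap F σ) (boundaryToColimOn F h) (toColimOn F L σ hL)
      (colimOnIncl F (K := fun τ => L τ ∧ τ ≠ σ) fun _ hτ => hτ.1) := by
  refine ⟨⟨WeightedSystem.boundary_ext fun τ => ?_⟩,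
    ⟨PushoutCocone.IsColimit.mk _ (fun s => ?_) ?_ ?_ ?_⟩⟩
  · rw [← Category.assoc, WeightedSystem.toBoundary_map, ← Category.assoc, toBoundary_toColimOn,
      toColimOn_incl, toColimOn_w τ.2.subset (h τ.1 τ.2).1 hL]
  · refine colimOnDesc (fun τ hτ => if e : τ = σ then eqToHom (by rw [e]) ≫ s.inl else
      toColimOn F _ τ ⟨hτ, e⟩ ≫ s.inr) ?_
    intro μ τ h' hμ hτ
    by_cases e : τ = σ
    · subst e
      by_cases e' : μ = τ
      · subst e'
        rw [dif_pos rfl]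
        exact (congrArg (· ≫ _) (F.map_id μ)).trans (Category.id_comp _)
      · rw [dif_pos rfl, dif_neg e', eqToHom_refl, Category.id_comp]
        have := toBoundary F τ ⟨μ, WeightedSystem.ssub h' e'⟩ ≫= s.condition
        rwa [← Category.assoc, WeightedSystem.toBoundary_map, ← Category.assoc,
          toBoundary_toColimOn] at this
    · have e' : μ ≠ σ := (hL' μ τ h' ⟨hτ, e⟩).2
      rw [dif_neg e, dif_neg e', ← Category.assoc, toColimOn_w h' ⟨hμ, e'⟩ ⟨hτ, e⟩]
  · intro s
    rw [toColimOn_desc, dif_pos rfl, eqToHom_refl, Category.id_comp]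
  · intro s
    refine colimOn_ext fun τ hτ => ?_
    rw [← Category.assoc, toColimOn_incl, toColimOn_desc, dif_neg hτ.2]
  · intro s k h₁ h₂
    refine colimOn_ext fun τ hτ => ?_
    rw [toColimOn_desc]
    by_cases e : τ = σ
    · subst e
      rw [dif_pos rfl, eqToHom_refl, Category.id_comp, h₁]
    · rw [dif_neg e, ← h₂, ← Category.assoc, toColimOn_incl]

/-- `σ` is terminal among its own faces. Results about complexes thereby apply to single faces. -/
theorem isIso_toColimOn_subset (F : Finset (Fin m) ⥤ TopCat.{u}) (σ : Finset (Fin m)) :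
    IsIso (toColimOn F (· ⊆ σ) σ subset_rfl) := by
  refine ⟨colimOnDesc (fun τ hτ => F.map (homOfLE hτ)) fun μ τ h _ _ => (F.map_comp _ _).symm,
    ?_, colimOn_ext fun τ hτ => ?_⟩
  · rw [toColimOn_desc]
    exact F.map_id σ
  · rw [← Category.assoc, toColimOn_desc, Category.comp_id]
    exact toColimOn_w (K := (· ⊆ σ)) hτ hτ subset_rfl

theorem he_colimOnMap_of_empty {F G : Finset (Fin m) ⥤ TopCat.{u}} (α : F ⟶ G) :
    HE (colimOnMap (fun _ => False) α) := by
  have : IsIso (colimOnMap (fun _ => False) α) :=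
    ⟨colimOnDesc (fun _ h => h.elim) fun _ _ _ h => h.elim, colimOn_ext fun _ h => h.elim,
      colimOn_ext fun _ h => h.elim⟩
  exact HE.of_isIso _

/-! ### Homotopy equivalences of pointed pairs -/

/-- The inverse has to be pointed although the basepoint need not be a cofibration. A pointed
inverse on the smallest space `E` is extended strictly to `S` and then to `P`, so the basepoint
keeps its image. The homotopies are only required to preserve the subspace. -/
theorem isHomotopyEquivOfPairs_of_hep {E E' S S' P P' : TopCat.{u}} {b : E ⟶ S} {d : S ⟶ P}
    {b' : E' ⟶ S'} {d' : S' ⟶ P'} (hb : HEP b) (hd : HEP d) (hb' : HEP b') (hd' : HEP d')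
    {fE : E ⟶ E'} {fS : S ⟶ S'} {fP : P ⟶ P'} (eS : b ≫ fS = fE ≫ b') (eP : d ≫ fP = fS ≫ d')
    (hS : HE fS) (hP : HE fP) {g : E' ⟶ E} (h₁ : Htp (𝟙 E) (fE ≫ g)) (h₂ : Htp (𝟙 E') (g ≫ fE))
    {x : E} {x' : E'} (hx : fE x = x') (hx' : g x' = x) :
    IsHomotopyEquivOfPairs (Set.range d) (d (b x)) (Set.range d') (d' (b' x')) fP.hom := by
  obtain ⟨gS, egS, ⟨_, hS₁, -, -, l₀, l₁, -⟩, ⟨_, hS₂, -, -, r₀, r₁, -⟩⟩ :=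
    hb.exists_inverse_extending hb' eS hS h₁ h₂
  obtain ⟨gP, egP, ⟨k, h, -, -, H₀, H₁, e⟩, ⟨k', h', -, -, H₀', H₁', e'⟩⟩ :=
    hd.exists_inverse_extending hd' eP hP ⟨hS₁, l₀, l₁⟩ ⟨hS₂, r₀, r₁⟩
  have cS (y) : gS (b' y) = b (g y) := ConcreteCategory.congr_hom egS y
  have cP (y) : gP (d' y) = d (gS y) := ConcreteCategory.congr_hom egP y
  have cS' (y) : fS (b y) = b' (fE y) := ConcreteCategory.congr_hom eS y
  have cP' (y) : fP (d y) = d' (fS y) := ConcreteCategory.congr_hom eP y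
  have toHtp {Q : TopCat.{u}} {q : Q ⟶ Q} (h : Q ⟶ Pth Q) (h₀ : h ≫ ev Q 0 = 𝟙 Q)
      (h₁ : h ≫ ev Q 1 = q) : ∃ H : (ContinuousMap.id Q).Homotopy q.hom,
        ∀ t x, H (t, x) = (h x : C(unitInterval, Q)) t :=
    ⟨⟨⟨fun p => (h p.2 : C(unitInterval, Q)) p.1, (continuous_uncurryPth h).comp continuous_swap⟩,
      fun x => ConcreteCategory.congr_hom h₀ x, fun x => ConcreteCategory.congr_hom h₁ x⟩,
      fun _ _ => rfl⟩
  obtain ⟨H, hH⟩ := toHtp h H₀ H₁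
  obtain ⟨H', hH'⟩ := toHtp h' H₀' H₁'
  refine ⟨⟨?_, ?_⟩, gP.hom, ⟨?_, ?_⟩, ⟨H, ?_⟩, ⟨H', ?_⟩⟩
  · rintro _ ⟨y, rfl⟩
    exact ⟨fS y, (cP' y).symm⟩
  · exact (cP' _).trans (congrArg d' ((cS' x).trans (congrArg b' hx)))
  · rintro _ ⟨y, rfl⟩
    exact ⟨gS y, (cP y).symm⟩
  · exact (cP _).trans (congrArg d ((cS x').trans (congrArg b hx')))
  · rintro t _ ⟨y, rfl⟩
    exact ⟨(k y : C(unitInterval, S)) t, by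
      rw [hH]
      exact (congrArg (fun w : C(unitInterval, P) => w t) (ConcreteCategory.congr_hom e y)).symm⟩
  · rintro t _ ⟨y, rfl⟩
    exact ⟨(k' y : C(unitInterval, S')) t, by
      rw [hH']
      exact (congrArg (fun w : C(unitInterval, P') => w t) (ConcreteCategory.congr_hom e' y)).symm⟩

end TopHtpy

/-! ### Cofibrations and homotopy equivalences of weighted polyhedral products. -/

namespace WeightedSystem

open TopHtpy

variable {X Y : Fin m → PowerCouple.{u}} {c : PowerSequence m} (W : WeightedSystem X c)
  {V : WeightedSystem Y c} {φ : ∀ i, (X i).Hom (Y i)}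

/-- Adding a maximal face to a complex attaches a polyhedral product along its boundary. -/
theorem isPushout_attach {L : Finset (Fin m) → Prop} {σ : Finset (Fin m)} (hL : L σ)
    (hL' : IsComplex fun τ => L τ ∧ τ ≠ σ) (h : ∀ τ, τ ⊂ σ → L τ ∧ τ ≠ σ) :
    IsPushout (boundaryMap (polyFunctor X) σ) (W.ηBoundary σ ≫ boundaryToColimOn W.functor h)
      (W.η σ ≫ toColimOn W.functor L σ hL)
      (colimOnIncl W.functor (K := fun τ => L τ ∧ τ ≠ σ) fun _ hτ => hτ.1) :=
  (W.isPushout_boundaryMap σ).paste_vert (isPushout_colimOn hL hL' h)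

theorem hep_boundaryMap (S : ∀ i, StromData (X i).sub) (σ : Finset (Fin m)) :
    HEP (boundaryMap W.functor σ) :=
  (hep_boundaryMap_poly S σ).pushout (W.isPushout_boundaryMap σ)

/-- Faces are added one at a time, each by a pushout of an unweighted boundary inclusion. -/
theorem hep_colimOnIncl (S : ∀ i, StromData (X i).sub) {K L : Finset (Fin m) → Prop}
    (hK : IsComplex K) (hL : IsComplex L) (h : ∀ τ, K τ → L τ) : HEP (colimOnIncl W.functor h) := by
  suffices ∀ h : ∀ τ, K τ → L τ, HEP (colimOnIncl W.functor h) from this h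
  refine hK.induction (P := fun L => ∀ h : ∀ τ, K τ → L τ, HEP (colimOnIncl W.functor h))
    ?_ ?_ hL h
  · intro h
    have : colimOnIncl W.functor h = 𝟙 _ :=
      colimOn_ext fun τ hτ => by rw [toColimOn_incl, Category.comp_id]
    rw [this]
    exact HEP.of_isIso _
  · intro L σ hL hσ hL' hKL ih h
    have hb (τ) (hτ : τ ⊂ σ) : L τ ∧ τ ≠ σ := ⟨hL τ σ hτ.subset hσ, hτ.ne⟩
    have := (ih hKL).comp ((hep_boundaryMap_poly S σ).pushout (W.isPushout_attach hσ hL' hb))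
    have e : colimOnIncl W.functor hKL ≫ colimOnIncl W.functor
        (K := fun τ => L τ ∧ τ ≠ σ) (fun _ hτ => hτ.1) = colimOnIncl W.functor h :=
      colimOn_ext fun τ hτ => by
        rw [← Category.assoc, toColimOn_incl, toColimOn_incl, toColimOn_incl]
    rwa [e] at this

theorem hep_toColimOn (S : ∀ i, StromData (X i).sub) {L : Finset (Fin m) → Prop}
    (hL : IsComplex L) (τ : Finset (Fin m)) (hτ : L τ) : HEP (toColimOn W.functor L τ hτ) := by
  have := isIso_toColimOn_subset W.functor τ
  rw [← toColimOn_incl (K := (· ⊆ τ)) (fun μ hμ => hL μ τ hμ hτ) τ subset_rfl]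
  exact (HEP.of_isIso _).comp (W.hep_colimOnIncl S (isComplex_subset τ) hL _)

theorem hep_incl (S : ∀ i, StromData (X i).sub) {τ σ : Finset (Fin m)} (h : τ ⊆ σ) :
    HEP (W.incl h) := by
  by_cases e : τ = σ
  · subst e
    rw [incl_rfl]
    exact HEP.of_isIso _
  · have h₁ := toBoundary_map W.functor σ ⟨τ, ssub h e⟩
    have h₂ : W.incl h = toBoundary W.functor σ ⟨τ, ssub h e⟩ ≫ boundaryMap W.functor σ :=
      h₁.symm
    rw [h₂]
    exact (W.hep_toColimOn S (isComplex_ssubset σ) τ (ssub h e)).comp (W.hep_boundaryMap S σ)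

section Equivalence

variable {W} {Φ : W.functor ⟶ V.functor} (hΦ : ∀ σ, W.η σ ≫ Φ.app σ = polyMap φ σ ≫ V.η σ)
  (SX : ∀ i, StromData (X i).sub) (SY : ∀ i, StromData (Y i).sub)
  (hφ : ∀ i, (φ i).IsHomotopyEquiv)
include hΦ

theorem ηBoundary_boundaryTrans (σ : Finset (Fin m)) :
    W.ηBoundary σ ≫ boundaryTrans Φ σ = boundaryTrans (polyMapTrans φ) σ ≫ V.ηBoundary σ := by
  refine boundary_ext fun τ => ?_
  have e : toBoundary (polyFunctor X) σ τ ≫ boundaryTrans (polyMapTrans φ) σ =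
      polyMap φ τ.1 ≫ toBoundary (polyFunctor Y) σ τ := toBoundary_trans _ τ
  rw [← Category.assoc, W.toBoundary_ηBoundary, Category.assoc, Category.assoc, toBoundary_trans,
    reassoc_of% hΦ τ.1, reassoc_of% polyPow_polyMap φ, reassoc_of% e, V.toBoundary_ηBoundary]

/-- Through the isomorphisms `η ∅` the map is the product of the `φ i` on the subspaces, and the
inverses of the `φ i` are maps of pointed pairs. -/
theorem exists_pointed_inverse_empty (hφ : ∀ i, (φ i).IsHomotopyEquiv) : ∃ g : V.obj ∅ ⟶ W.obj ∅, g (V.base ∅) = W.base ∅ ∧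
    Htp (𝟙 _) (Φ.app ∅ ≫ g) ∧ Htp (𝟙 _) (g ≫ Φ.app ∅) := by
  obtain ⟨γ, hγ, hγ', -⟩ := exists_polyMap_inverse hφ
  have := W.isIso_η_empty
  have := V.isIso_η_empty
  have eΦ : Φ.app ∅ = inv (W.η ∅) ≫ polyMap φ ∅ ≫ V.η ∅ := by
    rw [← hΦ, IsIso.inv_hom_id_assoc]
  refine ⟨inv (V.η ∅) ≫ γ.app ∅ ≫ W.η ∅, ?_, ?_, ?_⟩
  · rw [← V.η_base, ← W.η_base, ← hγ]
    exact congrArg (W.η ∅) (congrArg (γ.app ∅)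
      (ConcreteCategory.congr_hom (IsIso.hom_inv_id (V.η ∅)) _))
  · have := ((hγ' ∅).1.comp_right (W.η ∅)).comp_left (inv (W.η ∅))
    rw [Category.id_comp, IsIso.inv_hom_id] at this
    simpa [eΦ] using this
  · have := ((hγ' ∅).2.comp_right (V.η ∅)).comp_left (inv (V.η ∅))
    rw [Category.id_comp, IsIso.inv_hom_id] at this
    simpa [eΦ] using this

include SX SY hφ

/-- Starting from the empty complex, each added face is handled by the gluing lemma. The maps on the
attached space and on its boundary are unweighted, so they are equivalences by products of the given
inverses; the smaller complex is covered by induction. -/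
theorem he_colimOnMap {L : Finset (Fin m) → Prop} (hL : IsComplex L) : HE (colimOnMap L Φ) := by
  obtain ⟨γ, -, hγ, hK⟩ := exists_polyMap_inverse hφ
  refine IsComplex.induction (K := fun _ => False) (fun _ _ _ h => h)
    (P := fun L => HE (colimOnMap L Φ)) (he_colimOnMap_of_empty Φ) ?_ hL fun _ h => h.elim
  intro L σ hL hσ hL' _ ih
  have hb (τ) (hτ : τ ⊂ σ) : L τ ∧ τ ≠ σ := ⟨hL τ σ hτ.subset hσ, hτ.ne⟩
  refine HE.glue (W.isPushout_attach hσ hL' hb) (V.isPushout_attach hσ hL' hb)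
    (hep_boundaryMap_poly SX σ) (hep_boundaryMap_poly SY σ)
    (fA := boundaryTrans (polyMapTrans φ) σ) (fX := polyMap φ σ) (hK _) ⟨_, hγ σ⟩ ih
    (boundaryMap_app (polyMapTrans φ) σ) ?_ ?_ ?_
  · have e : boundaryToColimOn W.functor hb ≫ colimOnMap (fun τ => L τ ∧ τ ≠ σ) Φ =
        boundaryTrans Φ σ ≫ boundaryToColimOn V.functor hb := by
      refine boundary_ext fun τ => ?_
      rw [← Category.assoc, toBoundary_toColimOn, toColimOn_map, ← Category.assoc,
        toBoundary_trans, Category.assoc, toBoundary_toColimOn]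
    rw [Category.assoc, e, reassoc_of% ηBoundary_boundaryTrans hΦ σ]
  · rw [Category.assoc, toColimOn_map, reassoc_of% hΦ σ]
  · refine colimOn_ext fun τ hτ => ?_
    rw [← Category.assoc, toColimOn_incl, toColimOn_map, ← Category.assoc, toColimOn_map,
      Category.assoc, toColimOn_incl]

theorem he_app (σ : Finset (Fin m)) : HE (Φ.app σ) := by
  have h := he_colimOnMap hΦ SX SY hφ (isComplex_subset σ)
  have hW := isIso_toColimOn_subset W.functor σ
  have hV := isIso_toColimOn_subset V.functor σ
  refine (HE.of_isIso (toColimOn V.functor (· ⊆ σ) σ subset_rfl)).of_comp_right ?_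
  rw [← toColimOn_map]
  exact (HE.of_isIso _).comp h

theorem isHomotopyEquivOfPairs_faceSet {τ σ : Finset (Fin m)} (h : τ ⊆ σ) :
    IsHomotopyEquivOfPairs (W.faceSet h) (W.base σ) (V.faceSet h) (V.base σ) (Φ.app σ).hom := by
  obtain ⟨g, hg, h₁, h₂⟩ := exists_pointed_inverse_empty hΦ hφ
  have := isHomotopyEquivOfPairs_of_hep (W.hep_incl SX (Finset.empty_subset τ)) (W.hep_incl SX h)
    (V.hep_incl SY (Finset.empty_subset τ)) (V.hep_incl SY h) (incl_app Φ _) (incl_app Φ h)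
    (he_app hΦ SX SY hφ τ) (he_app hΦ SX SY hφ σ) h₁ h₂ (app_base hΦ ∅) hg
  rwa [W.map_base, W.map_base, V.map_base, V.map_base] at this

theorem isHomotopyEquivOfPairs_boundarySet (σ : Finset (Fin m)) :
    IsHomotopyEquivOfPairs (W.boundarySet σ) (W.base σ) (V.boundarySet σ) (V.base σ)
      (Φ.app σ).hom := by
  rcases σ.eq_empty_or_nonempty with rfl | hσ
  · have hW (x) (hx : x ∈ W.boundarySet ∅) : False := by
      obtain ⟨y, -⟩ := hx
      obtain ⟨τ, -, -⟩ := exists_toBoundary_eq _ _ y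
      exact Finset.not_ssubset_empty _ τ.2
    have hV (x) (hx : x ∈ V.boundarySet ∅) : False := by
      obtain ⟨y, -⟩ := hx
      obtain ⟨τ, -, -⟩ := exists_toBoundary_eq _ _ y
      exact Finset.not_ssubset_empty _ τ.2
    -- The boundary of the empty face is empty, so the inverse and homotopies for the pair with `τ =
    -- ∅` serve, and the conditions on the subspaces are vacuous.
    obtain ⟨⟨-, h₀⟩, g, ⟨-, hg⟩, ⟨H, -⟩, ⟨K, -⟩⟩ :=
      isHomotopyEquivOfPairs_faceSet hΦ SX SY hφ (subset_refl ∅)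
    exact ⟨⟨fun x hx => (hW x hx).elim, h₀⟩, g, ⟨fun x hx => (hV x hx).elim, hg⟩,
      ⟨H, fun _ x hx => (hW x hx).elim⟩, ⟨K, fun _ x hx => (hV x hx).elim⟩⟩
  · obtain ⟨g, hg, h₁, h₂⟩ := exists_pointed_inverse_empty hΦ hφ
    have hlt : ∅ ⊂ σ := Finset.empty_ssubset.2 hσ
    have := isHomotopyEquivOfPairs_of_hep (b := toBoundary W.functor σ ⟨∅, hlt⟩)
      (b' := toBoundary V.functor σ ⟨∅, hlt⟩) (W.hep_toColimOn SX (isComplex_ssubset σ) ∅ hlt)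
      (W.hep_boundaryMap SX σ) (V.hep_toColimOn SY (isComplex_ssubset σ) ∅ hlt)
      (V.hep_boundaryMap SY σ) (toBoundary_trans Φ _) (boundaryMap_app Φ σ)
      (he_colimOnMap hΦ SX SY hφ (isComplex_ssubset σ)) (he_app hΦ SX SY hφ σ) h₁ h₂
      (app_base hΦ ∅) hg
    rwa [toBoundary_boundaryMap, toBoundary_boundaryMap, W.map_base, V.map_base] at this

end Equivalence

end WeightedSystem

/-! ### The proposition. -/

theorem mainTheorem5 {m : ℕ} (c : PowerSequence m) (X Y : Fin m → PowerCouple.{u})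
    (W : WeightedSystem X c) (V : WeightedSystem Y c) (φ : ∀ i, (X i).Hom (Y i)) :
    ∃ Φ : ∀ σ : Finset (Fin m), W.obj σ ⟶ V.obj σ,
      -- the maps are pointed and compatible with the inclusions and with the maps `η`
      (∀ σ, Φ σ (W.base σ) = V.base σ) ∧
      (∀ (τ σ : Finset (Fin m)) (h : τ ⊆ σ), W.incl h ≫ Φ σ = Φ τ ≫ V.incl h) ∧
      (∀ σ, W.η σ ≫ Φ σ = polyMap φ σ ≫ V.η σ) ∧
      -- they are unique, even among all families of continuous maps
      (∀ Ψ : ∀ σ : Finset (Fin m), W.obj σ ⟶ V.obj σ,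
        (∀ (τ σ : Finset (Fin m)) (h : τ ⊆ σ), W.incl h ≫ Ψ σ = Ψ τ ≫ V.incl h) →
        (∀ σ, W.η σ ≫ Ψ σ = polyMap φ σ ≫ V.η σ) → Ψ = Φ) ∧
      -- homeomorphisms of pairs
      ((∀ i, (φ i).IsHomeomorphism) → ∀ σ,
        (∀ (τ : Finset (Fin m)) (h : τ ⊆ σ), IsHomeomorphismOfPairs
          (W.faceSet h) (W.base σ) (V.faceSet h) (V.base σ) (Φ σ).hom) ∧
        IsHomeomorphismOfPairs
          (W.boundarySet σ) (W.base σ) (V.boundarySet σ) (V.base σ) (Φ σ).hom) ∧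
      -- homotopy equivalences of pairs
      ((∀ i, (X i).IsCW) → (∀ i, (Y i).IsCW) → (∀ i, (φ i).IsHomotopyEquiv) → ∀ σ,
        (∀ (τ : Finset (Fin m)) (h : τ ⊆ σ), IsHomotopyEquivOfPairs
          (W.faceSet h) (W.base σ) (V.faceSet h) (V.base σ) (Φ σ).hom) ∧
        IsHomotopyEquivOfPairs
          (W.boundarySet σ) (W.base σ) (V.boundarySet σ) (V.base σ) (Φ σ).hom) := by
  open WeightedSystem in
  obtain ⟨Φ, hΦ⟩ := W.exists_trans V φ
  refine ⟨Φ.app, app_base hΦ, fun _ _ h => incl_app Φ h, hΦ, fun Ψ h h' => ?_, fun hφ σ => ?_,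
    fun hX hY hφ σ => ?_⟩
  · exact trans_unique h (fun _ _ h => incl_app Φ h) fun σ => by rw [h', hΦ]
  · choose ψ hψ hψ' using fun i => (hφ i).exists_inverse
    obtain ⟨Ψ, hΨ⟩ := V.exists_trans W ψ
    have h₁ := congrArg TopCat.Hom.hom (comp_eq_id hΦ hΨ hψ σ)
    have h₂ := congrArg TopCat.Hom.hom (comp_eq_id hΨ hΦ hψ' σ)
    exact ⟨fun τ h => ⟨⟨app_mapsTo_faceSet Φ h, app_base hΦ σ⟩, (Ψ.app σ).hom,
      ⟨app_mapsTo_faceSet Ψ h, app_base hΨ σ⟩, h₁, h₂⟩,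
      ⟨app_mapsTo_boundarySet Φ σ, app_base hΦ σ⟩, (Ψ.app σ).hom,
      ⟨app_mapsTo_boundarySet Ψ σ, app_base hΨ σ⟩, h₁, h₂⟩
  · have SX (i) := (hX i).nonempty_stromData.some
    have SY (i) := (hY i).nonempty_stromData.some
    exact ⟨fun τ h => isHomotopyEquivOfPairs_faceSet hΦ SX SY hφ h,
      isHomotopyEquivOfPairs_boundarySet hΦ SX SY hφ σ⟩
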